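/- Let $k$ be a commutative ring (for instance a field), $n\ge 0$, and $R=k[x_1,\dots,x_{n+1}]$, on which the simple transposition $s_i=(i,i+1)\in S_{n+1}$ acts by exchanging $x_i$ and $x_{i+1}$; let $R^i$ be the subring of $s_i$-invariants ($1\le i\le n$). Write $\otimes=\otimes_R$ and let $B_i=R\otimes_{R^i}R$, an $R$-bimodule. Let $\mathcal{SC}_1$ be the full subcategory of the category of $R$-bimodules (all bimodule homomorphisms, of any degree) whose objects are $B_{i_1\cdots i_d}=B_{i_1}\otimes\cdots\otimes B_{i_d}$, one for each finite sequence $i_1\cdots i_d$ of indices in $\{1,\dots,n\}$, with $B_\emptyset=R$. Its Hom sets are left $R$-modules through $(rf)(m)=r\,f(m)$, and it is monoidal under $\otimes$ (concatenation of sequences, with the canonical associativity and unit isomorphisms treated as identities). Consider bimodule isomorphisms $$B_i\otimes B_i\cong B_i\oplus B_i,\qquad B_i\otimes B_j\cong B_j\otimes B_i\ \ (|i-j|\ge 2),$$ $$(B_i\otimes B_{i+1}\otimes B_i)\oplus B_{i+1}\cong(B_{i+1}\otimes B_i\otimes B_{i+1})\oplus B_i,$$ which lift the relations of the Hecke algebra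 of $S_{n+1}$ (gradings disregarded), and, for each $i$, a unit $R\to B_i\otimes B_i$ and a counit $B_i\otimes B_i\to R$ that satisfy the two zigzag identities, i.e. make $B_i$ self-biadjoint. Such isomorphisms, units and counits exist. Choose any, one for each admissible $i$ or pair $i,j$, and let $\mathcal C$ be the subcategory of $\mathcal{SC}_1$, with the same objects, whose morphisms are those obtained by left $R$-linear combinations, compositions and tensor products from the identity morphisms and the following morphisms: 1. the generating morphisms $R\to B_i$, $1\mapsto x_i\otimes 1-1\otimes x_{i+1}$; 2. the chosen isomorphisms and their inverses, where an isomorphism between direct sums contributes its components, i.e. its composites with the inclusion of each summand of the source and the projection to each summand of the target; 3. the chosen units and counits. Then $\mathcal C$ is a full subcategory of $\mathcal{SC}_1$, that is, $\mathcal C=\mathcal{SC}_1$. -/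

import Mathlib

namespace Soergel

open CategoryTheory MonoidalCategory Limits MulOpposite
open scoped TensorProduct

universe u

/-! ### Bimodules over a commutative ring

An `R`-bimodule is an abelian group with commuting left and right `R`-actions; following the
Mathlib convention the right action `m ↦ m r` is written `op r • m`. -/

/-- An `R`-bimodule. -/
structure RBimod (R : Type u) [CommRing R] where
  carrier : Type u
  [addCommGroup : AddCommGroup carrier]
  [leftModule : Module R carrier]
  [rightModule : Module Rᵐᵒᵖ carrier]
  [smulCommClass : SMulCommClass R Rᵐᵒᵖ carrier]

namespace RBimod

variable {R : Type u} [CommRing R]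

instance : CoeSort (RBimod R) (Type u) := ⟨RBimod.carrier⟩

attribute [instance] addCommGroup leftModule rightModule smulCommClass

instance (M : RBimod R) : SMulCommClass Rᵐᵒᵖ R M := SMulCommClass.symm R Rᵐᵒᵖ M

/-- A homomorphism of bimodules: an additive map commuting with the left and the right action. -/
@[ext]
structure Hom (M N : RBimod R) where
  toLin : M →ₗ[R] N
  map_right : ∀ (r : R) (m : M), toLin (op r • m) = op r • toLin m

/-- `R`-bimodules and bimodule homomorphisms form a category. -/
instance : Category (RBimod R) where
  Hom M N := Hom M N
  id M := ⟨LinearMap.id, fun _ _ => rfl⟩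
  comp f g := ⟨g.toLin ∘ₗ f.toLin, fun r m => by simp [f.map_right, g.map_right]⟩

variable {M N P Q : RBimod R}

instance : FunLike (M ⟶ N) M N where
  coe f := f.toLin
  coe_injective _ _ h := Hom.ext (DFunLike.coe_injective h)

instance : AddMonoidHomClass (M ⟶ N) M N where
  map_add f := f.toLin.map_add
  map_zero f := f.toLin.map_zero

theorem hom_ext {f g : M ⟶ N} (h : ∀ m, f m = g m) : f = g := DFunLike.ext f g h

@[simp] theorem map_left (f : M ⟶ N) (r : R) (m : M) : f (r • m) = r • f m :=
  f.toLin.map_smul r m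

@[simp] theorem map_op (f : M ⟶ N) (r : R) (m : M) : f (op r • m) = op r • f m :=
  f.map_right r m

@[simp] theorem id_apply (m : M) : (𝟙 M : M ⟶ M) m = m := rfl

@[simp] theorem comp_apply (f : M ⟶ N) (g : N ⟶ P) (m : M) : (f ≫ g) m = g (f m) := rfl

/-- Build a bimodule homomorphism from an additive map. -/
def mkHom (f : M →+ N) (hl : ∀ (r : R) (m : M), f (r • m) = r • f m)
    (hr : ∀ (r : R) (m : M), f (op r • m) = op r • f m) : M ⟶ N :=
  Hom.mk { f with map_smul' := hl } hr

@[simp] theorem mkHom_apply (f : M →+ N) (hl) (hr) (m : M) : mkHom f hl hr m = f m := rfl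

/-! The Hom sets are left `R`-modules, through `(r f)(m) = r f(m)`. -/

instance : Zero (M ⟶ N) := ⟨Hom.mk 0 (by simp)⟩
instance : Add (M ⟶ N) := ⟨fun f g => Hom.mk (f.toLin + g.toLin) fun r m => by
  simp [f.map_right, g.map_right]⟩
instance : Neg (M ⟶ N) := ⟨fun f => Hom.mk (-f.toLin) fun r m => by simp [f.map_right]⟩
instance : Sub (M ⟶ N) := ⟨fun f g => Hom.mk (f.toLin - g.toLin) fun r m => by
  simp [f.map_right, g.map_right, smul_sub]⟩
instance : SMul ℕ (M ⟶ N) := ⟨fun s f => Hom.mk (s • f.toLin) fun r m => by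
  simp [f.map_right, smul_comm s]⟩
instance : SMul ℤ (M ⟶ N) := ⟨fun s f => Hom.mk (s • f.toLin) fun r m => by
  simp [f.map_right, smul_comm s]⟩
instance : SMul R (M ⟶ N) := ⟨fun s f => Hom.mk (s • f.toLin) fun r m => by
  simp [f.map_right, smul_comm s]⟩

instance : AddCommGroup (M ⟶ N) :=
  Function.Injective.addCommGroup (fun f : M ⟶ N => (f : M → N)) DFunLike.coe_injective rfl
    (fun _ _ => rfl) (fun _ => rfl) (fun _ _ => rfl) (fun _ _ => rfl) (fun _ _ => rfl)

instance : Module R (M ⟶ N) :=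
  Function.Injective.module R
    ({ toFun := fun f => (f : M → N), map_zero' := rfl, map_add' := fun _ _ => rfl } :
      (M ⟶ N) →+ (M → N)) DFunLike.coe_injective (fun _ _ => rfl)

@[simp] theorem zero_apply (m : M) : (0 : M ⟶ N) m = 0 := rfl
@[simp] theorem add_apply (f g : M ⟶ N) (m : M) : (f + g) m = f m + g m := rfl
@[simp] theorem smul_apply (r : R) (f : M ⟶ N) (m : M) : (r • f) m = r • f m := rfl

instance : Preadditive (RBimod R) where
  add_comp _ _ _ f f' g := hom_ext fun m => by simp
  comp_add _ _ _ f g g' := hom_ext fun m => by simp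

instance : Linear R (RBimod R) where
  smul_comp _ _ _ r f g := hom_ext fun m => by simp
  comp_smul _ _ _ f r g := hom_ext fun m => by simp

/-! ### Direct sums -/

/-- The direct sum of two bimodules. -/
abbrev dsum (M N : RBimod R) : RBimod R where
  carrier := M × N

/-- The direct sum, with its inclusions and projections. -/
def dsumBicone (M N : RBimod R) : BinaryBicone M N where
  pt := dsum M N
  fst := mkHom (AddMonoidHom.fst M N) (fun _ _ => rfl) (fun _ _ => rfl)
  snd := mkHom (AddMonoidHom.snd M N) (fun _ _ => rfl) (fun _ _ => rfl)
  inl := mkHom (AddMonoidHom.inl M N) (fun r _ => Prod.ext rfl (smul_zero r).symm)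
    (fun r _ => Prod.ext rfl (smul_zero (op r)).symm)
  inr := mkHom (AddMonoidHom.inr M N) (fun r _ => Prod.ext (smul_zero r).symm rfl)
    (fun r _ => Prod.ext (smul_zero (op r)).symm rfl)
  inl_fst := rfl
  inl_snd := rfl
  inr_fst := rfl
  inr_snd := rfl

instance : HasBinaryBiproducts (RBimod R) where
  has_binary_biproduct M N := HasBinaryBiproduct.mk
    { bicone := dsumBicone M N
      isBilimit := isBinaryBilimitOfTotal _ (hom_ext fun m => by
        obtain ⟨a, b⟩ := (m : M × N)
        exact Prod.ext (add_zero a) (zero_add b)) }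

/-! ### The tensor product over `R` -/

/-- The underlying group of `M`, on which `R` acts through the right action of `M`. -/
def Rt (M : RBimod R) : Type u := M

instance : AddCommGroup (Rt M) := inferInstanceAs (AddCommGroup M)
instance : Module R (Rt M) := Module.compHom M (RingEquiv.toOpposite R).toRingHom

/-- The underlying group of `M ⊗ N`: the tensor product over `R` of the right module
`M` and the left module `N`. -/
def Tens (M N : RBimod R) : Type u := Rt M ⊗[R] N

instance : AddCommGroup (Tens M N) := inferInstanceAs (AddCommGroup (Rt M ⊗[R] N))

/-- The left action of `R` on `M`, as endomorphisms of the right module `M`. -/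
def leftEnd (M : RBimod R) : R →+* Module.End R (Rt M) where
  toFun r :=
    { toFun := DistribSMul.toAddMonoidHom M r
      map_add' := fun m m' => smul_add (A := M) r m m'
      map_smul' := fun s m => smul_comm (α := M) r (op s) m }
  map_one' := LinearMap.ext fun m => one_smul (α := M) R m
  map_mul' r s := LinearMap.ext fun m => mul_smul (β := M) r s m
  map_zero' := LinearMap.ext fun m => zero_smul (A := M) R m
  map_add' r s := LinearMap.ext fun m => add_smul (M := M) r s m

/-- The right action of `R` on `N`, as endomorphisms of the left module `N`. -/
def rightEnd (N : RBimod R) : Rᵐᵒᵖ →+* Module.End R N := Module.toModuleEnd R (S := Rᵐᵒᵖ) N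

/-- `R` acts on `M ⊗ N` from the left through `M`. -/
instance : Module R (Tens M N) :=
  Module.compHom (Rt M ⊗[R] N)
    ((Module.End.rTensorAlgHom R (Rt M) N).toRingHom.comp (leftEnd M))

/-- `R` acts on `M ⊗ N` from the right through `N`. -/
instance : Module Rᵐᵒᵖ (Tens M N) :=
  Module.compHom (Rt M ⊗[R] N)
    ((Module.End.lTensorAlgHom R N (Rt M)).toRingHom.comp (rightEnd N))

/-- The pure tensor `m ⊗ n`. -/
def tmul (m : M) (n : N) : Tens M N := TensorProduct.tmul R (M := Rt M) m n

theorem smul_tmul (r : R) (m : M) (n : N) : r • tmul m n = tmul (r • m) n := rfl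

theorem op_smul_tmul (r : R) (m : M) (n : N) : op r • tmul m n = tmul m (op r • n) := rfl

/-- `m r ⊗ n = m ⊗ r n`. -/
theorem tmul_balanced (r : R) (m : M) (n : N) : tmul (op r • m) n = tmul m (r • n) :=
  TensorProduct.smul_tmul (R := R) (M := Rt M) r m n

theorem add_tmul (m m' : M) (n : N) : tmul (m + m') n = tmul m n + tmul m' n :=
  TensorProduct.add_tmul (R := R) (M := Rt M) m m' n

theorem tmul_add (m : M) (n n' : N) : tmul m (n + n') = tmul m n + tmul m n' :=
  TensorProduct.tmul_add (R := R) (M := Rt M) m n n'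

theorem zero_tmul (n : N) : tmul (0 : M) n = 0 := TensorProduct.zero_tmul (R := R) (Rt M) n

theorem tmul_zero (m : M) : tmul m (0 : N) = 0 := TensorProduct.tmul_zero (R := R) (M := Rt M) N m

@[elab_as_elim]
theorem tens_induction {p : Tens M N → Prop} (x : Tens M N) (h0 : p 0)
    (ht : ∀ m n, p (tmul m n)) (ha : ∀ x y, p x → p y → p (x + y)) : p x :=
  TensorProduct.induction_on (motive := p) x h0 ht ha

/-- The universal property: a balanced biadditive map factors through `M ⊗ N`. -/
def tensLift {A : Type*} [AddCommGroup A] (f : M →+ N →+ A)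
    (hf : ∀ (r : R) (m : M) (n : N), f (op r • m) n = f m (r • n)) : Tens M N →+ A :=
  TensorProduct.liftAddHom (R := R) (M := Rt M) f hf

@[simp] theorem tensLift_tmul {A : Type*} [AddCommGroup A] (f : M →+ N →+ A) (hf) (m : M)
    (n : N) : tensLift f hf (tmul m n) = f m n := rfl

instance : SMulCommClass R Rᵐᵒᵖ (Tens M N) where
  smul_comm r s x := by
    induction x using tens_induction with
    | h0 => simp
    | ht m n => rfl
    | ha x y hx hy => simp only [smul_add, hx, hy]

/-- The tensor product `M ⊗_R N` of bimodules. -/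
abbrev tensor (M N : RBimod R) : RBimod R where
  carrier := Tens M N

/-- Two homomorphisms out of `M ⊗ N` that agree on pure tensors are equal. -/
theorem tensor_hom_ext {f g : tensor M N ⟶ P} (h : ∀ m n, f (tmul m n) = g (tmul m n)) :
    f = g := hom_ext fun x => by
  induction x using tens_induction with
  | h0 => exact (map_zero f).trans (map_zero g).symm
  | ht m n => exact h m n
  | ha x y hx hy => exact (map_add f x y).trans ((congrArg₂ _ hx hy).trans (map_add g x y).symm)

/-- A homomorphism out of `M ⊗ N`, given by a balanced biadditive map compatible with the outer
actions. -/
def tensDesc (f : M →+ N →+ P)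
    (hf : ∀ (r : R) (m : M) (n : N), f (op r • m) n = f m (r • n))
    (hl : ∀ (r : R) (m : M) (n : N), f (r • m) n = r • f m n)
    (hr : ∀ (r : R) (m : M) (n : N), f m (op r • n) = op r • f m n) : tensor M N ⟶ P :=
  mkHom (M := tensor M N) (tensLift f hf)
    (fun r x => by
      induction x using tens_induction with
      | h0 => exact (congrArg _ (smul_zero r)).trans (by simp)
      | ht m n => exact hl r m n
      | ha x y hx hy =>
        refine (congrArg _ (smul_add r x y)).trans ?_
        rw [map_add, hx, hy, map_add, smul_add])
    (fun r x => by
      induction x using tens_induction with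
      | h0 => exact (congrArg _ (smul_zero (op r))).trans (by simp)
      | ht m n => exact hr r m n
      | ha x y hx hy =>
        refine (congrArg _ (smul_add (op r) x y)).trans ?_
        rw [map_add, hx, hy, map_add, smul_add])

@[simp] theorem tensDesc_tmul (f : M →+ N →+ P) (hf) (hl) (hr) (m : M) (n : N) :
    tensDesc f hf hl hr (tmul m n) = f m n := rfl

/-- The bimodule `R` itself. -/
abbrev unit (R : Type u) [CommRing R] : RBimod R where
  carrier := R

/-- `f ⊗ g`, sending `m ⊗ n` to `f m ⊗ g n`. -/
def tensorMap (f : M ⟶ P) (g : N ⟶ Q) : tensor M N ⟶ tensor P Q :=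
  tensDesc (P := tensor P Q)
    (AddMonoidHom.mk' (fun m => AddMonoidHom.mk' (fun n => (tmul (f m) (g n) : Tens P Q))
        fun n n' => by rw [map_add, tmul_add])
      fun m m' => AddMonoidHom.ext fun n => by
        change tmul (f (m + m')) (g n) = tmul (f m) (g n) + tmul (f m') (g n)
        rw [map_add, add_tmul])
    (fun r m n => by
      change tmul (f (op r • m)) (g n) = tmul (f m) (g (r • n))
      rw [map_op, map_left, tmul_balanced])
    (fun r m n => by
      change tmul (f (r • m)) (g n) = r • tmul (f m) (g n)
      rw [map_left, smul_tmul])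
    (fun r m n => by
      change tmul (f m) (g (op r • n)) = op r • tmul (f m) (g n)
      rw [map_op, op_smul_tmul])

@[simp] theorem tensorMap_tmul (f : M ⟶ P) (g : N ⟶ Q) (m : M) (n : N) :
    tensorMap f g (tmul m n) = tmul (f m) (g n) := rfl

/-- The pure tensor `m ⊗ n`, as a biadditive map. -/
def tmulHom (M N : RBimod R) : M →+ N →+ Tens M N :=
  AddMonoidHom.mk' (fun m => AddMonoidHom.mk' (fun n => tmul m n) (tmul_add m))
    fun m m' => AddMonoidHom.ext fun n => add_tmul m m' n

/-- `(m ⊗ n) ⊗ p ↦ m ⊗ (n ⊗ p)`. -/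
def assocHom (M N P : RBimod R) : tensor (tensor M N) P ⟶ tensor M (tensor N P) :=
  tensDesc (M := tensor M N) (N := P) (P := tensor M (tensor N P))
    (tensLift
      (AddMonoidHom.mk' (fun m =>
          (AddMonoidHom.compHom (tmulHom M (tensor N P) m)).comp (tmulHom N P))
        fun m m' => by
          ext n p
          exact add_tmul (N := tensor N P) m m' (tmul n p))
      (fun r m n => by
        ext p
        exact tmul_balanced (N := tensor N P) r m (tmul n p)))
    (fun r x p => by
      induction x using tens_induction with
      | h0 => rw [smul_zero, map_zero]; rfl
      | ht m n => exact congrArg (tmul (N := tensor N P) m) (tmul_balanced r n p)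
      | ha x y hx hy =>
        rw [smul_add, map_add, map_add]
        exact congrArg₂ (· + ·) hx hy)
    (fun r x p => by
      induction x using tens_induction with
      | h0 => rw [smul_zero, map_zero]; exact (smul_zero r).symm
      | ht m n => rfl
      | ha x y hx hy =>
        rw [smul_add, map_add, map_add]
        exact (congrArg₂ (· + ·) hx hy).trans (smul_add r _ _).symm)
    (fun r x p => by
      induction x using tens_induction with
      | h0 => rw [map_zero]; exact (smul_zero (op r)).symm
      | ht m n => rfl
      | ha x y hx hy =>
        rw [map_add]
        exact (congrArg₂ (· + ·) hx hy).trans (smul_add (op r) _ _).symm)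

/-- `m ⊗ (n ⊗ p) ↦ (m ⊗ n) ⊗ p`. -/
def assocInv (M N P : RBimod R) : tensor M (tensor N P) ⟶ tensor (tensor M N) P :=
  tensDesc (M := M) (N := tensor N P) (P := tensor (tensor M N) P)
    (AddMonoidHom.mk' (fun m => tensLift ((tmulHom (tensor M N) P).comp (tmulHom M N m))
        (fun r n p => tmul_balanced (M := tensor M N) r (tmul m n) p))
      fun m m' => by
        ext x
        induction x using tens_induction with
        | h0 => simp
        | ht n p =>
          exact (congrArg (fun z => tmul (M := tensor M N) z p) (add_tmul m m' n)).trans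
            (add_tmul (M := tensor M N) (tmul m n) (tmul m' n) p)
        | ha x y hx hy =>
          exact (map_add _ x y).trans ((congrArg₂ (· + ·) hx hy).trans (map_add _ x y).symm))
    (fun r m x => by
      induction x using tens_induction with
      | h0 => rw [smul_zero, map_zero, map_zero]
      | ht n p => exact congrArg (fun z => tmul (M := tensor M N) z p) (tmul_balanced r m n)
      | ha x y hx hy => rw [smul_add, map_add, map_add, hx, hy])
    (fun r m x => by
      induction x using tens_induction with
      | h0 => rw [map_zero, map_zero, smul_zero]
      | ht n p => rfl
      | ha x y hx hy => rw [map_add, map_add, hx, hy, smul_add])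
    (fun r m x => by
      induction x using tens_induction with
      | h0 => rw [smul_zero, map_zero, smul_zero]
      | ht n p => rfl
      | ha x y hx hy => rw [smul_add, map_add, map_add, hx, hy, smul_add])

@[simp] theorem assocHom_tmul (m : M) (n : N) (p : P) :
    assocHom M N P (tmul (M := tensor M N) (tmul m n) p)
      = tmul (N := tensor N P) m (tmul n p) := rfl

@[simp] theorem assocInv_tmul (m : M) (n : N) (p : P) :
    assocInv M N P (tmul (N := tensor N P) m (tmul n p))
      = tmul (M := tensor M N) (tmul m n) p := rfl

/-- `r ⊗ m ↦ r m`. -/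
def lUnitHom (M : RBimod R) : tensor (unit R) M ⟶ M :=
  tensDesc (M := unit R)
    (AddMonoidHom.mk' (fun r : R => DistribSMul.toAddMonoidHom M r) fun r s => by
      ext m
      exact add_smul r s m)
    (fun r s m => mul_smul (s : R) r m)
    (fun r s m => mul_smul r (s : R) m)
    (fun r s m => smul_comm (s : R) (op r) m)

/-- `m ↦ 1 ⊗ m`. -/
def lUnitInv (M : RBimod R) : M ⟶ tensor (unit R) M :=
  mkHom (N := tensor (unit R) M) (tmulHom (unit R) M (1 : R))
    (fun r m => by
      refine (tmul_balanced (M := unit R) r (1 : R) m).symm.trans ?_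
      refine congrArg (fun z : unit R => tmul z m) ?_
      change (1 : R) * r = r * 1
      rw [mul_comm])
    (fun _ _ => rfl)

/-- `m ⊗ r ↦ m r`. -/
def rUnitHom (M : RBimod R) : tensor M (unit R) ⟶ M :=
  tensDesc (N := unit R)
    (AddMonoidHom.mk' (fun m : M => AddMonoidHom.mk' (fun r : R => op r • m)
        fun r s => add_smul (op (r : R)) (op (s : R)) m)
      fun m m' => by
        ext r
        exact smul_add (op (r : R)) m m')
    (fun r m s => (mul_smul (op (s : R)) (op r) m).symm)
    (fun r m s => smul_comm (op (s : R)) r m)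
    (fun r m s => mul_smul (op r) (op (s : R)) m)

/-- `m ↦ m ⊗ 1`. -/
def rUnitInv (M : RBimod R) : M ⟶ tensor M (unit R) :=
  mkHom (N := tensor M (unit R)) ((tmulHom M (unit R)).flip (1 : R))
    (fun _ _ => rfl)
    (fun r m => by
      refine (tmul_balanced (N := unit R) r m (1 : R)).trans ?_
      refine congrArg (fun z : unit R => tmul m z) ?_
      change r * (1 : R) = 1 * r
      rw [mul_comm])

/-- `R`-bimodules form a monoidal category under `⊗_R`, with unit `R`. -/
instance : MonoidalCategoryStruct (RBimod R) where
  tensorObj := tensor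
  whiskerLeft M _ _ f := tensorMap (𝟙 M) f
  whiskerRight f N := tensorMap f (𝟙 N)
  tensorHom f g := tensorMap f g
  tensorUnit := unit R
  associator M N P :=
    { hom := assocHom M N P
      inv := assocInv M N P
      hom_inv_id := tensor_hom_ext fun x p => by
        induction x using tens_induction with
        | h0 => rw [zero_tmul (M := tensor M N)]; simp
        | ht m n => rfl
        | ha x y hx hy => rw [add_tmul (M := tensor M N)]; simp only [map_add, hx, hy]
      inv_hom_id := tensor_hom_ext fun m x => by
        induction x using tens_induction with
        | h0 => rw [tmul_zero (N := tensor N P)]; simp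
        | ht n p => rfl
        | ha x y hx hy => rw [tmul_add (N := tensor N P)]; simp only [map_add, hx, hy] }
  leftUnitor M :=
    { hom := lUnitHom M
      inv := lUnitInv M
      hom_inv_id := tensor_hom_ext fun r m => by
        refine (tmul_balanced (M := unit R) (r : R) (1 : R) m).symm.trans ?_
        refine congrArg (fun z : unit R => tmul z m) ?_
        exact one_mul (r : R)
      inv_hom_id := hom_ext fun m => one_smul R m }
  rightUnitor M :=
    { hom := rUnitHom M
      inv := rUnitInv M
      hom_inv_id := tensor_hom_ext fun m r => by
        refine (tmul_balanced (N := unit R) (r : R) m (1 : R)).trans ?_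
        refine congrArg (fun z : unit R => tmul m z) ?_
        exact mul_one (r : R)
      inv_hom_id := hom_ext fun m => one_smul Rᵐᵒᵖ m }

/-- Two homomorphisms out of `(M ⊗ N) ⊗ P` that agree on pure tensors are equal. -/
theorem tensor_hom_ext₃ {f g : tensor (tensor M N) P ⟶ Q}
    (h : ∀ m n p, f (tmul (M := tensor M N) (tmul m n) p)
      = g (tmul (M := tensor M N) (tmul m n) p)) : f = g :=
  tensor_hom_ext fun x p => by
    induction x using tens_induction with
    | h0 => rw [zero_tmul (M := tensor M N)]; simp
    | ht m n => exact h m n p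
    | ha x y hx hy => rw [add_tmul (M := tensor M N)]; simp only [map_add, hx, hy]

/-- Two homomorphisms out of `((M ⊗ N) ⊗ P) ⊗ Q` that agree on pure tensors are equal. -/
theorem tensor_hom_ext₄ {L : RBimod R} {f g : tensor (tensor (tensor M N) P) Q ⟶ L}
    (h : ∀ m n p q,
      f (tmul (M := tensor (tensor M N) P) (tmul (M := tensor M N) (tmul m n) p) q)
      = g (tmul (M := tensor (tensor M N) P) (tmul (M := tensor M N) (tmul m n) p) q)) : f = g :=
  tensor_hom_ext₃ fun x p q => by
    induction x using tens_induction with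
    | h0 => rw [zero_tmul (M := tensor M N), zero_tmul (M := tensor (tensor M N) P)]; simp
    | ht m n => exact h m n p q
    | ha x y hx hy =>
      rw [add_tmul (M := tensor M N), add_tmul (M := tensor (tensor M N) P)]
      simp only [map_add, hx, hy]

instance : MonoidalCategory (RBimod R) where
  tensorHom_def _ _ := tensor_hom_ext fun _ _ => rfl
  id_tensorHom_id _ _ := tensor_hom_ext fun _ _ => rfl
  tensorHom_comp_tensorHom _ _ _ _ := tensor_hom_ext fun _ _ => rfl
  whiskerLeft_id _ _ := tensor_hom_ext fun _ _ => rfl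
  id_whiskerRight _ _ := tensor_hom_ext fun _ _ => rfl
  associator_naturality _ _ _ := tensor_hom_ext₃ fun _ _ _ => rfl
  leftUnitor_naturality f := tensor_hom_ext fun r m => (map_left f r m).symm
  rightUnitor_naturality f := tensor_hom_ext fun m r => (map_op f r m).symm
  pentagon _ _ _ _ := tensor_hom_ext₄ fun _ _ _ _ => rfl
  triangle _ _ := tensor_hom_ext₃ fun m r n => (tmul_balanced (r : R) m n).symm

/-- The homomorphism `R ⟶ M`, `r ↦ r v`, attached to an element `v` with `v r = r v` for all `r`. -/
def ofCentral (v : M) (hv : ∀ r : R, op r • v = r • v) : 𝟙_ (RBimod R) ⟶ M :=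
  mkHom (M := unit R) (AddMonoidHom.mk' (fun r : R => r • v) fun r s => add_smul (r : R) s v)
    (fun r s => mul_smul r (s : R) v)
    (fun r s => by
      change ((s : R) * r) • v = op r • (s : R) • v
      rw [smul_comm (op r) (s : R) v, hv, mul_smul])

end RBimod

/-! ### Soergel bimodules for the symmetric group `S_{n+1}`

An index `i ∈ {1, …, n}` is an element of `Fin n`, and the variables
`x_i`, `x_{i+1}` are `X i.castSucc`, `X i.succ`. -/

/-- `R = k[x_1, …, x_{n+1}]`. -/
abbrev Poly (k : Type u) [CommRing k] (n : ℕ) : Type u := MvPolynomial (Fin (n + 1)) k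

variable (k : Type u) [CommRing k] {n : ℕ}

/-- The simple transposition `s_i` acting on `R` by exchanging `x_i` and `x_{i+1}`. -/
noncomputable def refl (i : Fin n) : Poly k n →ₐ[k] Poly k n :=
  MvPolynomial.rename (Equiv.swap i.castSucc i.succ)

/-- The subalgebra `R^i` of `s_i`-invariant polynomials. -/
noncomputable def invariants (i : Fin n) : Subalgebra k (Poly k n) :=
  AlgHom.equalizer (refl k i) (AlgHom.id k (Poly k n))

/-- The ring `R ⊗_{R^i} R`. -/
def BSCarrier (i : Fin n) : Type u := Poly k n ⊗[invariants k i] Poly k n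

noncomputable instance (i : Fin n) : CommRing (BSCarrier k i) :=
  inferInstanceAs (CommRing (Poly k n ⊗[invariants k i] Poly k n))

/-- `f ⊗ g ∈ R ⊗_{R^i} R`. -/
noncomputable def bt (i : Fin n) (f g : Poly k n) : BSCarrier k i := f ⊗ₜ[invariants k i] g

/-- `f ↦ f ⊗ 1`. -/
noncomputable def inclLeft (i : Fin n) : Poly k n →+* BSCarrier k i :=
  (Algebra.TensorProduct.includeLeft (R := invariants k i) (S := invariants k i)
    (A := Poly k n) (B := Poly k n)).toRingHom

/-- `g ↦ 1 ⊗ g`. -/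
noncomputable def inclRight (i : Fin n) : Poly k n →+* BSCarrier k i :=
  (Algebra.TensorProduct.includeRight (R := invariants k i)
    (A := Poly k n) (B := Poly k n)).toRingHom

noncomputable instance (i : Fin n) : Module (Poly k n) (BSCarrier k i) :=
  Module.compHom (BSCarrier k i) (inclLeft k i)

noncomputable instance (i : Fin n) : Module (Poly k n)ᵐᵒᵖ (BSCarrier k i) :=
  Module.compHom (BSCarrier k i)
    ((inclRight k i).comp (RingEquiv.toOpposite (Poly k n)).symm.toRingHom)

theorem left_smul_def (i : Fin n) (r : Poly k n) (x : BSCarrier k i) :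
    r • x = inclLeft k i r * x := rfl

theorem right_smul_def (i : Fin n) (r : Poly k n) (x : BSCarrier k i) :
    op r • x = inclRight k i r * x := rfl

instance (i : Fin n) : SMulCommClass (Poly k n) (Poly k n)ᵐᵒᵖ (BSCarrier k i) where
  smul_comm r s x := by
    induction s using MulOpposite.rec' with
    | h s => rw [left_smul_def, right_smul_def, right_smul_def, left_smul_def, mul_left_comm]

theorem smul_bt (i : Fin n) (r f g : Poly k n) : r • bt k i f g = bt k i (r * f) g := by
  refine (Algebra.TensorProduct.tmul_mul_tmul (R := invariants k i) r f 1 g).trans ?_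
  rw [one_mul]; rfl

theorem op_smul_bt (i : Fin n) (r f g : Poly k n) : op r • bt k i f g = bt k i f (g * r) := by
  refine (Algebra.TensorProduct.tmul_mul_tmul (R := invariants k i) 1 f r g).trans ?_
  rw [one_mul, mul_comm]; rfl

/-- The Soergel bimodule `B_i = R ⊗_{R^i} R`, with `r (f ⊗ g) s = r f ⊗ g s`. Its grading plays
no role here, as all bimodule homomorphisms are considered, not only those of degree zero. -/
noncomputable def Bs (i : Fin n) : RBimod (Poly k n) where
  carrier := BSCarrier k i

theorem mem_invariants (i : Fin n) (f : Poly k n) : f ∈ invariants k i ↔ refl k i f = f :=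
  Iff.rfl

theorem inclLeft_eq_inclRight (i : Fin n) {f : Poly k n} (hf : f ∈ invariants k i) :
    inclLeft k i f = inclRight k i f := by
  have := TensorProduct.smul_tmul (R := invariants k i) (⟨f, hf⟩ : invariants k i)
    (1 : Poly k n) (1 : Poly k n)
  have e : (⟨f, hf⟩ : invariants k i) • (1 : Poly k n) = f := mul_one f
  rw [e] at this
  exact this

open MvPolynomial in
theorem X_mem_invariants (i : Fin n) {j : Fin (n + 1)} (h : j ≠ i.castSucc) (h' : j ≠ i.succ) :
    (X j : Poly k n) ∈ invariants k i := by
  rw [mem_invariants, refl, rename_X, Equiv.swap_apply_of_ne_of_ne h h']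

open MvPolynomial in
theorem sum_mem_invariants (i : Fin n) :
    (X i.castSucc + X i.succ : Poly k n) ∈ invariants k i := by
  rw [mem_invariants, refl, map_add, rename_X, rename_X, Equiv.swap_apply_left,
    Equiv.swap_apply_right, add_comm]

open MvPolynomial in
theorem prod_mem_invariants (i : Fin n) :
    (X i.castSucc * X i.succ : Poly k n) ∈ invariants k i := by
  rw [mem_invariants, refl, map_mul, rename_X, rename_X, Equiv.swap_apply_left,
    Equiv.swap_apply_right, mul_comm]

/-- The element `x_i ⊗ 1 - 1 ⊗ x_{i+1}` of `B_i`. -/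
noncomputable def dotElt (i : Fin n) : BSCarrier k i :=
  bt k i (MvPolynomial.X i.castSucc) 1 - bt k i 1 (MvPolynomial.X i.succ)

open MvPolynomial in
theorem dotElt_central (i : Fin n) (r : Poly k n) : op r • dotElt k i = r • dotElt k i := by
  have hd : dotElt k i = inclLeft k i (X i.castSucc) - inclRight k i (X i.succ) := rfl
  have hs := inclLeft_eq_inclRight k i (sum_mem_invariants k i)
  have hp := inclLeft_eq_inclRight k i (prod_mem_invariants k i)
  rw [map_add, map_add] at hs
  rw [map_mul, map_mul] at hp
  rw [left_smul_def, right_smul_def]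
  induction r using MvPolynomial.induction_on with
  | C a =>
    have : (C a : Poly k n) ∈ invariants k i := (invariants k i).algebraMap_mem a
    rw [inclLeft_eq_inclRight k i this]
  | add p q hp hq => rw [map_add, map_add, add_mul, add_mul, hp, hq]
  | mul_X p j h =>
    rw [map_mul, map_mul, mul_right_comm, h, mul_right_comm, mul_assoc, mul_assoc]
    congr 1
    by_cases h1 : j = i.castSucc
    · subst h1
      rw [hd]
      linear_combination (-inclLeft k i (X i.castSucc)) * hs + hp
    by_cases h2 : j = i.succ
    · subst h2
      rw [hd]
      linear_combination (inclRight k i (X i.succ)) * hs - hp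
    rw [inclLeft_eq_inclRight k i (X_mem_invariants k i h1 h2)]

/-- The generating morphism `R ⟶ B_i`, sending `1` to `x_i ⊗ 1 - 1 ⊗ x_{i+1}`. -/
noncomputable def dot (i : Fin n) : 𝟙_ (RBimod (Poly k n)) ⟶ Bs k i :=
  RBimod.ofCentral (M := Bs k i) (dotElt k i) (dotElt_central k i)

/-! ### The category of Bott-Samelson bimodules -/

/-- `B_{i_1 … i_d} = B_{i_1} ⊗ ⋯ ⊗ B_{i_d}`, with `R` for the empty sequence. -/
noncomputable def BS : List (Fin n) → RBimod (Poly k n)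
  | [] => 𝟙_ _
  | i :: w => Bs k i ⊗ BS w

/-- The canonical identification `B_{v w} ≅ B_v ⊗ B_w` for the concatenation of two sequences. -/
noncomputable def BSappend : ∀ v w : List (Fin n), BS k (v ++ w) ≅ BS k v ⊗ BS k w
  | [], w => (λ_ (BS k w)).symm
  | i :: v, w => whiskerLeftIso (Bs k i) (BSappend v w) ≪≫ (α_ _ _ _).symm

/-- The canonical identification `B_{(i)} ≅ B_i`. -/
noncomputable def BS₁ (i : Fin n) : BS k [i] ≅ Bs k i := ρ_ (Bs k i)

/-- The canonical identification `B_{i j} ≅ B_i ⊗ B_j`. -/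
noncomputable def BS₂ (i j : Fin n) : BS k [i, j] ≅ Bs k i ⊗ Bs k j :=
  whiskerLeftIso (Bs k i) (BS₁ k j)

/-- The canonical identification `B_{i j l} ≅ B_i ⊗ (B_j ⊗ B_l)`. -/
noncomputable def BS₃ (i j l : Fin n) : BS k [i, j, l] ≅ Bs k i ⊗ Bs k j ⊗ Bs k l :=
  whiskerLeftIso (Bs k i) (BS₂ k j l)

variable (n) in
/-- The category `SC₁`: the full subcategory of `R`-bimodules on the objects `B_w`, one for every
finite sequence `w` of indices. (All of them are finitely generated free left `R`-modules, so that
this is also a full subcategory of the bimodules that are finitely generated on the left.) -/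
abbrev SC₁ : Type := InducedCategory (RBimod (Poly k n)) (BS k (n := n))

/-- The tensor product of morphisms of `SC₁`: for `f : B_v ⟶ B_w` and `g : B_v' ⟶ B_w'` it is
`f ⊗ g`, seen as a morphism from `B_{v v'}` to `B_{w w'}`. -/
noncomputable def SC₁.tensorHom {v w v' w' : List (Fin n)} (f : BS k v ⟶ BS k w)
    (g : BS k v' ⟶ BS k w') : BS k (v ++ v') ⟶ BS k (w ++ w') :=
  (BSappend k v v').hom ≫ (f ⊗ₘ g) ≫ (BSappend k w w').inv

variable (n) in
/-- A choice of isomorphisms of bimodules that lift the relations of the Hecke algebra,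
`b_i b_i = (t + t⁻¹) b_i`, `b_i b_j = b_j b_i` for `|i - j| ≥ 2`, and
`b_i b_{i+1} b_i + b_{i+1} = b_{i+1} b_i b_{i+1} + b_i`, together with a unit and a counit that
make every `B_i` a two-sided dual of itself. -/
structure HeckeChoice where
  square (i : Fin n) : Bs k i ⊗ Bs k i ≅ Bs k i ⊞ Bs k i
  distant (i j : Fin n) (h : (i : ℕ) + 2 ≤ j ∨ (j : ℕ) + 2 ≤ i) :
    Bs k i ⊗ Bs k j ≅ Bs k j ⊗ Bs k i
  braid (i j : Fin n) (h : (j : ℕ) = i + 1) :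
    (Bs k i ⊗ Bs k j ⊗ Bs k i) ⊞ Bs k j ≅ (Bs k j ⊗ Bs k i ⊗ Bs k j) ⊞ Bs k i
  selfDual (i : Fin n) : ExactPairing (Bs k i) (Bs k i)

variable {k}

/-- The generating morphisms attached to a choice `D`: the morphisms `R ⟶ B_i`, the chosen
isomorphisms and their inverses, restricted to each summand of the source and projected to each
summand of the target, and the chosen units and counits. -/
inductive IsGenerator (D : HeckeChoice k n) :
    ∀ {v w : List (Fin n)}, (BS k v ⟶ BS k w) → Prop
  | dot (i) : IsGenerator D (v := []) (w := [i]) (dot k i ≫ (BS₁ k i).inv)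
  | unit (i) : IsGenerator D (v := []) (w := [i, i])
      ((D.selfDual i).coevaluation' ≫ (BS₂ k i i).inv)
  | counit (i) : IsGenerator D (v := [i, i]) (w := [])
      ((BS₂ k i i).hom ≫ (D.selfDual i).evaluation')
  | square_fst (i) : IsGenerator D (v := [i, i]) (w := [i])
      ((BS₂ k i i).hom ≫ ((D.square i).hom ≫ biprod.fst) ≫ (BS₁ k i).inv)
  | square_snd (i) : IsGenerator D (v := [i, i]) (w := [i])
      ((BS₂ k i i).hom ≫ ((D.square i).hom ≫ biprod.snd) ≫ (BS₁ k i).inv)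
  | square_inl (i) : IsGenerator D (v := [i]) (w := [i, i])
      ((BS₁ k i).hom ≫ (biprod.inl ≫ (D.square i).inv) ≫ (BS₂ k i i).inv)
  | square_inr (i) : IsGenerator D (v := [i]) (w := [i, i])
      ((BS₁ k i).hom ≫ (biprod.inr ≫ (D.square i).inv) ≫ (BS₂ k i i).inv)
  | distant_hom (i j h) : IsGenerator D (v := [i, j]) (w := [j, i])
      ((BS₂ k i j).hom ≫ (D.distant i j h).hom ≫ (BS₂ k j i).inv)
  | distant_inv (i j h) : IsGenerator D (v := [j, i]) (w := [i, j])
      ((BS₂ k j i).hom ≫ (D.distant i j h).inv ≫ (BS₂ k i j).inv)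
  | braid_hom_inl_fst (i j h) : IsGenerator D (v := [i, j, i]) (w := [j, i, j])
      ((BS₃ k i j i).hom ≫ (biprod.inl ≫ (D.braid i j h).hom ≫ biprod.fst) ≫ (BS₃ k j i j).inv)
  | braid_hom_inl_snd (i j h) : IsGenerator D (v := [i, j, i]) (w := [i])
      ((BS₃ k i j i).hom ≫ (biprod.inl ≫ (D.braid i j h).hom ≫ biprod.snd) ≫ (BS₁ k i).inv)
  | braid_hom_inr_fst (i j h) : IsGenerator D (v := [j]) (w := [j, i, j])
      ((BS₁ k j).hom ≫ (biprod.inr ≫ (D.braid i j h).hom ≫ biprod.fst) ≫ (BS₃ k j i j).inv)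
  | braid_hom_inr_snd (i j h) : IsGenerator D (v := [j]) (w := [i])
      ((BS₁ k j).hom ≫ (biprod.inr ≫ (D.braid i j h).hom ≫ biprod.snd) ≫ (BS₁ k i).inv)
  | braid_inv_inl_fst (i j h) : IsGenerator D (v := [j, i, j]) (w := [i, j, i])
      ((BS₃ k j i j).hom ≫ (biprod.inl ≫ (D.braid i j h).inv ≫ biprod.fst) ≫ (BS₃ k i j i).inv)
  | braid_inv_inl_snd (i j h) : IsGenerator D (v := [j, i, j]) (w := [j])
      ((BS₃ k j i j).hom ≫ (biprod.inl ≫ (D.braid i j h).inv ≫ biprod.snd) ≫ (BS₁ k j).inv)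
  | braid_inv_inr_fst (i j h) : IsGenerator D (v := [i]) (w := [i, j, i])
      ((BS₁ k i).hom ≫ (biprod.inr ≫ (D.braid i j h).inv ≫ biprod.fst) ≫ (BS₃ k i j i).inv)
  | braid_inv_inr_snd (i j h) : IsGenerator D (v := [i]) (w := [j])
      ((BS₁ k i).hom ≫ (biprod.inr ≫ (D.braid i j h).inv ≫ biprod.snd) ≫ (BS₁ k j).inv)

/-- The morphisms obtained from the generating morphisms and the identities by left `R`-linear
combinations, compositions and tensor products. -/
inductive Generated (D : HeckeChoice k n) :
    ∀ {v w : List (Fin n)}, (BS k v ⟶ BS k w) → Prop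
  | of {v w} {f : BS k v ⟶ BS k w} (hf : IsGenerator D f) : Generated D f
  | id (w) : Generated D (𝟙 (BS k w))
  | comp {u v w} {f : BS k u ⟶ BS k v} {g : BS k v ⟶ BS k w} (hf : Generated D f)
      (hg : Generated D g) : Generated D (f ≫ g)
  | tensor {v w v' w'} {f : BS k v ⟶ BS k w} {g : BS k v' ⟶ BS k w'} (hf : Generated D f)
      (hg : Generated D g) : Generated D (SC₁.tensorHom k f g)
  | zero (v w) : Generated D (0 : BS k v ⟶ BS k w)
  | add {v w} {f g : BS k v ⟶ BS k w} (hf : Generated D f) (hg : Generated D g) :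
      Generated D (f + g)
  | smul {v w} (r : Poly k n) {f : BS k v ⟶ BS k w} (hf : Generated D f) : Generated D (r • f)

/-- The subcategory `C` of `SC₁` generated by the generating morphisms, with the same objects
as `SC₁`. -/
def subcategory (D : HeckeChoice k n) : MorphismProperty (SC₁ k n) :=
  fun _ _ f => Generated D f.hom

instance (D : HeckeChoice k n) : (subcategory D).IsMultiplicative where
  id_mem w := Generated.id (D := D) w
  comp_mem _ _ hf hg := Generated.comp (D := D) hf hg

end Soergel

/-! Fullness. A counit `B_i ⊗ B_i ⟶ R` turns a morphism `B_i ⊗ B_v ⟶ B_w` into a morphism `B_v ⟶ B_i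
⊗ B_w` from which it can be recovered (`Full.transpose`). It is therefore enough to generate every
`Hom(R, B_w)`. On the words `w` for which this is achieved there are two kinds of closure. (a) A
Hecke relation exhibits one product of `B_i`'s as a direct summand of a sum of simpler ones. A
morphism into it is thus a sum of morphisms into the simpler ones, followed by generators
(`Full.locallyReducible`). (b) Biadjointness permits rotation of `w`: `Hom(R, B_i ⊗ B_w)`, `Hom(B_i,
B_w)` and `Hom(R, B_w ⊗ B_i)` correspond (`Full.rotate`). With both, every word reduces to words
without repeated letters. The Hecke relations make the largest letter occur at most once
(`of_count_le_one`). Rotation then allows it to be split off, and the argument continues with a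
smaller alphabet (`forall_of_nodup`).

For `w` without repetitions, a morphism `R ⟶ B_w` is a central element of `B_w`. Each `B_i` is an
extension of `R` twisted by `s_i` by `R`, the latter spanned by the dot `x_i ⊗ 1 - 1 ⊗ x_{i+1}`. A
component involving a twist cannot be central, because no letter of `w` recurs to undo it
(`eq_zero_of_twisted`). So the central elements are the multiples of the tensor product of the dots,
which the generators `R ⟶ B_i` produce (`exists_eq_smul_dots`).

Existence of the choices. Every isomorphism comes from a surjection of a bimodule with `m` left
generators onto one that is left free of rank `m`, which is automatically bijective
(`isIso_of_surjective`). The models are `R ⊗_S R` with `S = R^i ∩ R^j`: `B_i B_j ≅ R ⊗_S R` for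
distant indices, and `B_i B_j B_i ≅ (R ⊗_S R) ⊕ B_i` for adjacent ones. Self-duality is the
Frobenius structure of `R` over `R^i` given by the Demazure operator `∂_i`. -/

namespace Soergel

open CategoryTheory MonoidalCategory Limits MulOpposite
open scoped TensorProduct

universe u

/-! ### Reduction of words -/

section Words

variable {n : ℕ}

/-- The number of occurrences of the letter `m - 1`. -/
def occ (m : ℕ) (x : List (Fin n)) : ℕ := x.countP fun j : Fin n => (j : ℕ) + 1 = m

theorem occ_append (m : ℕ) (x y : List (Fin n)) : occ m (x ++ y) = occ m x + occ m y :=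
  List.countP_append

theorem occ_cons_of_eq {m : ℕ} {t : Fin n} (h : (t : ℕ) + 1 = m) (x : List (Fin n)) :
    occ m (t :: x) = occ m x + 1 :=
  List.countP_cons_of_pos (by simpa using h)

theorem occ_cons_of_ne {m : ℕ} {t : Fin n} (h : (t : ℕ) + 1 ≠ m) (x : List (Fin n)) :
    occ m (t :: x) = occ m x :=
  List.countP_cons_of_neg (by simpa using h)

theorem occ_eq_zero {m : ℕ} {x : List (Fin n)} : occ m x = 0 ↔ ∀ j ∈ x, (j : ℕ) + 1 ≠ m := by
  simp [occ, List.countP_eq_zero]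

theorem exists_of_occ_ne_zero {m : ℕ} {x : List (Fin n)} (h : occ m x ≠ 0) :
    ∃ t ∈ x, (t : ℕ) + 1 = m := by
  simpa [occ_eq_zero] using h

theorem exists_two_occurrences {m : ℕ} {x : List (Fin n)} (hx : ∀ j ∈ x, (j : ℕ) < m + 1)
    (h : 1 < occ (m + 1) x) : ∃ (x₁ : List (Fin n)) (t : Fin n) (y x₂ : List (Fin n)),
      x = x₁ ++ t :: (y ++ t :: x₂) ∧ (t : ℕ) = m ∧ ∀ j ∈ y, (j : ℕ) < m := by
  induction x with
  | nil => simp [occ] at h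
  | cons s x ih =>
    by_cases hs : (s : ℕ) + 1 = m + 1
    · rw [occ_cons_of_eq hs] at h
      obtain ⟨j, hj, hjm⟩ := exists_of_occ_ne_zero (show occ (m + 1) x ≠ 0 by omega)
      obtain rfl : j = s := Fin.ext (by omega)
      -- The split is at the first further occurrence of the letter, so `y` avoids it and all its
      -- letters are `< m`.
      obtain ⟨y, z, rfl, hy⟩ := List.eq_append_cons_of_mem hj
      refine ⟨[], j, y, z, rfl, by omega, fun l hl => ?_⟩
      have h1 := hx l (by simp [hl])
      have h2 : (l : ℕ) ≠ j := fun e => hy (Fin.ext e ▸ hl)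
      omega
    · rw [occ_cons_of_ne hs] at h
      obtain ⟨x₁, t, y, x₂, rfl, ht, hy⟩ := ih (fun j hj => hx j (List.mem_cons_of_mem _ hj)) h
      exact ⟨s :: x₁, t, y, x₂, rfl, ht, hy⟩

/-- A property of words that can be deduced from the words obtained by applying a relation of the
Hecke algebra to a subword. -/
structure LocallyReducible (Q : List (Fin n) → Prop) : Prop where
  square (a b : List (Fin n)) (i : Fin n) : Q (a ++ i :: b) → Q (a ++ i :: i :: b)
  distant (a b : List (Fin n)) (i j : Fin n) (h : (i : ℕ) + 2 ≤ j ∨ (j : ℕ) + 2 ≤ i) :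
    Q (a ++ j :: i :: b) → Q (a ++ i :: j :: b)
  -- Only the direction that replaces two occurrences of the larger letter `j` by one is needed.
  braid (a b : List (Fin n)) (i j : Fin n) (h : (j : ℕ) = i + 1) :
    Q (a ++ i :: j :: i :: b) → Q (a ++ j :: b) → Q (a ++ j :: i :: j :: b)

namespace LocallyReducible

variable {Q : List (Fin n) → Prop}

/-- Lets an induction over smaller alphabets act on a subword while the rest of the word stays
fixed. -/
theorem context (hQ : LocallyReducible Q) (u v : List (Fin n)) :
    LocallyReducible fun x => Q (u ++ (x ++ v)) where
  square a b i h := by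
    have := hQ.square (u ++ a) (b ++ v) i (by simpa using h)
    simpa using this
  distant a b i j hij h := by
    have := hQ.distant (u ++ a) (b ++ v) i j hij (by simpa using h)
    simpa using this
  braid a b i j hij h h' := by
    have := hQ.braid (u ++ a) (b ++ v) i j hij (by simpa using h) (by simpa using h')
    simpa using this

theorem move_left (hQ : LocallyReducible Q) (a b : List (Fin n)) (m : Fin n) :
    ∀ y : List (Fin n), (∀ j ∈ y, (j : ℕ) + 2 ≤ m ∨ (m : ℕ) + 2 ≤ j) →
      Q (a ++ m :: (y ++ b)) → Q (a ++ (y ++ m :: b)) := by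
  intro y
  induction y generalizing a with
  | nil => intro _ h; simpa using h
  | cons j y ih =>
    intro hy h
    have := ih (a ++ [j]) (fun l hl => hy l (List.mem_cons_of_mem _ hl)) (by
      have := hQ.distant a (y ++ b) j m (hy j List.mem_cons_self) (by simpa using h)
      simpa using this)
    simpa using this

theorem move_right (hQ : LocallyReducible Q) (a b : List (Fin n)) (m : Fin n) :
    ∀ y : List (Fin n), (∀ j ∈ y, (j : ℕ) + 2 ≤ m ∨ (m : ℕ) + 2 ≤ j) →
      Q (a ++ (y ++ m :: b)) → Q (a ++ m :: (y ++ b)) := by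
  intro y
  induction y generalizing a with
  | nil => intro _ h; simpa using h
  | cons j y ih =>
    intro hy h
    have := ih (a ++ [j]) (fun l hl => hy l (List.mem_cons_of_mem _ hl)) (by simpa using h)
    exact hQ.distant a (y ++ b) m j (hy j List.mem_cons_self).symm (by simpa using this)

theorem move_block (hQ : LocallyReducible Q) (y b : List (Fin n)) :
    ∀ a p : List (Fin n), (∀ j ∈ y, ∀ m ∈ p, (j : ℕ) + 2 ≤ m) →
      Q (a ++ (y ++ (p ++ b))) → Q (a ++ (p ++ (y ++ b))) := by
  intro a p
  induction p generalizing a with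
  | nil => intro _ h; simpa using h
  | cons m p ih =>
    intro hy h
    have h1 := hQ.move_right a (p ++ b) m y
      (fun j hj => Or.inl (hy j hj m List.mem_cons_self)) (by simpa using h)
    have := ih (a ++ [m]) (fun j hj l hl => hy j hj l (List.mem_cons_of_mem _ hl))
      (by simpa using h1)
    simpa using this

/-- A word in the letters `< m` reduces to words in which `m - 1` occurs at most once. -/
theorem of_count_le_one (m : ℕ) : ∀ {Q : List (Fin n) → Prop}, LocallyReducible Q →
    (∀ x : List (Fin n), (∀ j ∈ x, (j : ℕ) < m) → occ m x ≤ 1 → Q x) →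
    ∀ x : List (Fin n), (∀ j ∈ x, (j : ℕ) < m) → Q x := by
  induction m with
  | zero =>
    intro Q _ h x hx
    exact h x hx ((occ_eq_zero.mpr (by simp)).le.trans zero_le_one)
  | succ m ih =>
    intro Q hQ h x hx
    -- Outer induction on the size of the alphabet, inner induction on the number of occurrences of
    -- its largest letter `m`.
    induction hc : occ (m + 1) x using Nat.strong_induction_on
      generalizing x with
    | _ c ihc =>
    by_cases hle : occ (m + 1) x ≤ 1
    · exact h x hx hle
    obtain ⟨x₁, t, y, x₂, rfl, ht, hy⟩ := exists_two_occurrences hx (not_le.mp hle)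
    have hx₁ : ∀ j ∈ x₁, (j : ℕ) < m + 1 := fun j hj => hx j (by simp [hj])
    have hx₂ : ∀ j ∈ x₂, (j : ℕ) < m + 1 := fun j hj => hx j (by simp [hj])
    have hcy : ∀ y : List (Fin n), (∀ j ∈ y, (j : ℕ) < m) →
        occ (m + 1) y = 0 := fun y hy => by
      rw [occ_eq_zero]
      intro j hj
      have := hy j hj
      omega
    have ht' : (t : ℕ) + 1 = m + 1 := by omega
    -- Putting `z` in place of `t y t` removes at least one occurrence of the largest letter, so the
    -- inner induction applies.
    have key : ∀ z : List (Fin n), (∀ j ∈ z, (j : ℕ) < m + 1) →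
        occ (m + 1) z ≤ 1 → Q (x₁ ++ (z ++ x₂)) := by
      intro z hz hz1
      refine ihc _ ?_ (x₁ ++ (z ++ x₂)) ?_ rfl
      · rw [← hc]
        simp only [occ_append, occ_cons_of_eq ht', hcy y hy]
        omega
      · intro j hj
        simp only [List.mem_append] at hj
        rcases hj with hj | hj | hj
        exacts [hx₁ j hj, hz j hj, hx₂ j hj]
    -- The outer induction, applied between the two letters `t`, allows `y` to be taken with at most
    -- one letter `m - 1`.
    have hQ' := hQ.context (x₁ ++ [t]) (t :: x₂)
    have := ih hQ' ?_ y hy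
    · simpa using this
    intro y' hy' hy1
    suffices Q (x₁ ++ t :: (y' ++ t :: x₂)) by simpa using this
    -- In the first case `t` commutes with all of `y'`, and `t t` shrinks to `t`. This covers `m =
    -- 0`, since `occ 0` vanishes identically.
    by_cases h0 : occ m y' = 0
    · rw [occ_eq_zero] at h0
      have hfar : ∀ j ∈ y', (j : ℕ) + 2 ≤ t ∨ (t : ℕ) + 2 ≤ j := fun j hj => by
        have h1 := hy' j hj
        have h2 := h0 j hj
        omega
      refine hQ.move_right x₁ (t :: x₂) t y' hfar ?_
      have := hQ.square (x₁ ++ y') x₂ t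
      rw [List.append_assoc, List.append_assoc] at this
      refine this ?_
      have := key (y' ++ [t]) (by
        intro j hj
        simp only [List.mem_append, List.mem_singleton] at hj
        rcases hj with hj | rfl
        · have := hy' j hj
          omega
        · omega) (by
          simp only [occ_append, occ_cons_of_eq ht', hcy y' hy']
          simp [occ])
      simpa using this
    · obtain ⟨s, hs, hsm⟩ := exists_of_occ_ne_zero h0
      have hsm' : (s : ℕ) + 1 ≠ m + 1 := by omega
      obtain ⟨a, b, rfl⟩ := List.append_of_mem hs
      have hab : occ m a = 0 ∧ occ m b = 0 := by
        rw [occ_append, occ_cons_of_eq hsm] at hy1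
        omega
      have ha : ∀ j ∈ a, (j : ℕ) + 2 ≤ t := fun j hj => by
        have h1 := hy' j (by simp [hj])
        have h2 := occ_eq_zero.mp hab.1 j hj
        omega
      have hb : ∀ j ∈ b, (j : ℕ) + 2 ≤ t := fun j hj => by
        have h1 := hy' j (by simp [hj])
        have h2 := occ_eq_zero.mp hab.2 j hj
        omega
      have hca := hcy a fun j hj => by have := ha j hj; omega
      have hcb := hcy b fun j hj => by have := hb j hj; omega
      -- With `y' = a s b`, the letter `t` commutes with `a` and `b`, so `t a s b t` becomes `a (t s
      -- t) b`. The braid rule leaves `a s t s b` and `a t b`, each with a single `t`.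
      have e1 := hQ.move_right x₁ (s :: (b ++ t :: x₂)) t a (fun j hj => Or.inl (ha j hj))
      rw [List.append_assoc, List.cons_append]
      refine e1 ?_
      have e2 := hQ.move_right (x₁ ++ (a ++ [t, s])) x₂ t b (fun j hj => Or.inl (hb j hj))
      have e3 := hQ.braid (x₁ ++ a) (b ++ x₂) s t (by omega)
      have k1 := key (a ++ s :: t :: s :: b) (by
        intro j hj
        simp only [List.mem_append, List.mem_cons] at hj
        rcases hj with hj | rfl | rfl | rfl | hj
        · have := ha j hj; omega
        · omega
        · omega
        · omega
        · have := hb j hj; omega) (by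
          simp only [occ_append, occ_cons_of_eq ht', occ_cons_of_ne hsm', hca, hcb]
          omega)
      have k2 := key (a ++ t :: b) (by
        intro j hj
        simp only [List.mem_append, List.mem_cons] at hj
        rcases hj with hj | rfl | hj
        · have := ha j hj; omega
        · omega
        · have := hb j hj; omega) (by
          simp only [occ_append, occ_cons_of_eq ht', hca, hcb]
          omega)
      have e4 := e3 (by simpa using k1) (by simpa using k2)
      have e5 := hQ.move_left (x₁ ++ (a ++ [t, s])) x₂ t b (fun j hj => Or.inl (hb j hj))
        (by simpa using e4)
      simpa using e5

/-- A locally reducible property of words that is invariant under rotation holds for all words as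
soon as it holds for the words without repetitions. -/
theorem forall_of_nodup (hQ : LocallyReducible Q) (hrot : ∀ i w, Q (i :: w) → Q (w ++ [i]))
    (hnd : ∀ w, w.Nodup → Q w) (w : List (Fin n)) : Q w := by
  have rot : ∀ v w : List (Fin n), Q (v ++ w) → Q (w ++ v) := by
    intro v
    induction v with
    | nil => intro w h; simpa using h
    | cons i v ih =>
      intro w h
      have := ih (w ++ [i]) (by simpa using hrot i (v ++ w) h)
      simpa using this
  -- The prefix `p` stores the large letters, each already reduced to a single occurrence; `x` is
  -- the part still to be treated.
  have main : ∀ (l : ℕ) (p : List (Fin n)), p.Nodup → (∀ j ∈ p, l ≤ (j : ℕ)) →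
      ∀ x : List (Fin n), (∀ j ∈ x, (j : ℕ) < l) → Q (p ++ x) := by
    intro l
    induction l with
    | zero =>
      intro p hp _ x hx
      have : x = [] := List.eq_nil_iff_forall_not_mem.mpr fun j hj => by simpa using hx j hj
      rw [this, List.append_nil]
      exact hnd p hp
    | succ l ih =>
      intro p hp hpl x hx
      have hQ' := hQ.context p []
      have := of_count_le_one (l + 1) hQ' ?_ x hx
      · simpa using this
      intro x hx hx1
      rw [List.append_nil]
      by_cases h0 : occ (l + 1) x = 0
      · refine ih p hp (fun j hj => (Nat.le_succ l).trans (hpl j hj)) x fun j hj => ?_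
        have h1 := hx j hj
        have h2 := occ_eq_zero.mp h0 j hj
        omega
      · obtain ⟨t, ht, htl⟩ := exists_of_occ_ne_zero h0
        obtain ⟨a, b, rfl⟩ := List.append_of_mem ht
        rw [occ_append, occ_cons_of_eq htl] at hx1
        have ha0 : occ (l + 1) a = 0 := by omega
        have hb0 : occ (l + 1) b = 0 := by omega
        have hab : ∀ j, j ∈ a ∨ j ∈ b → (j : ℕ) < l := fun j hj => by
          have h1 := hx j (by rcases hj with hj | hj <;> simp [hj])
          have h2 : ¬ (j : ℕ) + 1 = l + 1 := by
            rcases hj with hj | hj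
            exacts [occ_eq_zero.mp ha0 j hj, occ_eq_zero.mp hb0 j hj]
          omega
        -- In `p a t b`, the letters of `a` are `< l` and those of `p` are `> l`, so `a` commutes
        -- past `p` to the front. Rotation brings it to the end, and `t` joins the prefix.
        have := hQ.move_block a (t :: b) [] p (fun j hj m hm => by
          have h1 := hab j (Or.inl hj)
          have h2 := hpl m hm
          omega)
        refine this (rot (p ++ t :: b) a ?_)
        have := ih (p ++ [t]) (by
          rw [List.nodup_append]
          refine ⟨hp, by simp, fun j hj m hm => ?_⟩
          rw [List.mem_singleton] at hm
          subst hm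
          rintro rfl
          have := hpl j hj
          omega) (fun j hj => by
            simp only [List.mem_append, List.mem_singleton] at hj
            rcases hj with hj | rfl
            · have := hpl j hj; omega
            · omega) (b ++ a) (fun j hj => hab j (by
              simp only [List.mem_append] at hj; exact hj.symm))
        simpa using this
  simpa using main n [] (by simp) (by simp) w fun j _ => j.2

end LocallyReducible

end Words

section

variable (k : Type u) [CommRing k] {n : ℕ}

/-! ### Polynomials and the Demazure operators -/

section Polynomials

open MvPolynomial

/-- In a polynomial ring, the difference of two variables is not a zero divisor. -/
theorem eq_zero_of_mul_X_sub_X {σ : Type*} {c d : σ} (h : c ≠ d)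
    {a : MvPolynomial σ k} (ha : a * (X c - X d) = 0) : a = 0 := by
  classical
  -- As `k` may have zero divisors, an invertible change of variables is used: `φ` carries `X c - X
  -- d` to the regular element `X c`, and `ψ` undoes `φ`.
  let φ : MvPolynomial σ k →ₐ[k] MvPolynomial σ k :=
    aeval fun l => if l = c then X c + X d else X l
  let ψ : MvPolynomial σ k →ₐ[k] MvPolynomial σ k :=
    aeval fun l => if l = c then X c - X d else X l
  have hψφ : ψ.comp φ = AlgHom.id k _ := by
    ext l : 1
    by_cases hl : l = c
    · subst hl
      simp [φ, ψ, h.symm]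
    · simp [φ, ψ, hl]
  have h1 : φ a * X c = 0 := by
    have := congrArg φ ha
    simpa [φ, h.symm] using this
  have h2 : φ a = 0 := isRegular_X.right.mul_right_eq_zero_iff.mp h1
  have := DFunLike.congr_fun hψφ a
  simpa [h2] using this.symm

theorem X_mem_inf {i j : Fin n} {l : Fin (n + 1)} (h : l ≠ i.castSucc) (h' : l ≠ i.succ)
    (g : l ≠ j.castSucc) (g' : l ≠ j.succ) : (X l : Poly k n) ∈ invariants k i ⊓ invariants k j :=
  ⟨X_mem_invariants k i h h', X_mem_invariants k j g g'⟩

theorem refl_X_castSucc (i : Fin n) : refl k i (X i.castSucc) = X i.succ := by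
  rw [refl, rename_X, Equiv.swap_apply_left]

/-- `x_i` is a root of `T² - (x_i + x_{i+1}) T + x_i x_{i+1}`, whose coefficients are invariant, and
`x_{i+1} = (x_i + x_{i+1}) - x_i`. Hence `R^i + R^i x_i` is stable under multiplication by every
variable; no division by 2 is involved. -/
theorem exists_decomp_castSucc (i : Fin n) (f : Poly k n) :
    ∃ g ∈ invariants k i, ∃ h ∈ invariants k i, f = g + h * X i.castSucc := by
  have hs := sum_mem_invariants k i
  have hp := prod_mem_invariants k i
  induction f using MvPolynomial.induction_on with
  | C a => exact ⟨C a, (invariants k i).algebraMap_mem a, 0, zero_mem _, by simp⟩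
  | add f f' hf hf' =>
    obtain ⟨g, hg, h, hh, rfl⟩ := hf
    obtain ⟨g', hg', h', hh', rfl⟩ := hf'
    exact ⟨g + g', add_mem hg hg', h + h', add_mem hh hh', by ring⟩
  | mul_X f j hf =>
    obtain ⟨g, hg, h, hh, rfl⟩ := hf
    by_cases h1 : j = i.castSucc
    · subst h1
      exact ⟨-(h * (X i.castSucc * X i.succ)), neg_mem (mul_mem hh hp),
        g + h * (X i.castSucc + X i.succ), add_mem hg (mul_mem hh hs), by ring⟩
    by_cases h2 : j = i.succ
    · subst h2
      exact ⟨g * (X i.castSucc + X i.succ) + h * (X i.castSucc * X i.succ),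
        add_mem (mul_mem hg hs) (mul_mem hh hp), -g, neg_mem hg, by ring⟩
    have hX := X_mem_invariants k i h1 h2
    exact ⟨g * X j, mul_mem hg hX, h * X j, mul_mem hh hX, by ring⟩

theorem exists_decomp_succ (i : Fin n) (f : Poly k n) :
    ∃ g ∈ invariants k i, ∃ h ∈ invariants k i, f = g + h * X i.succ := by
  obtain ⟨g, hg, h, hh, rfl⟩ := exists_decomp_castSucc k i f
  exact ⟨g + h * (X i.castSucc + X i.succ), add_mem hg (mul_mem hh (sum_mem_invariants k i)),
    -h, neg_mem hh, by ring⟩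

/-- Subtracting the image under `s_i` leaves `(h - h') (x_i - x_{i+1}) = 0`, and the second factor
is regular. -/
theorem castSucc_coeff_unique {i : Fin n} {g h g' h' : Poly k n} (hg : g ∈ invariants k i)
    (hh : h ∈ invariants k i) (hg' : g' ∈ invariants k i) (hh' : h' ∈ invariants k i)
    (e : g + h * X i.castSucc = g' + h' * X i.castSucc) : h = h' := by
  have e' := congrArg (refl k i) e
  rw [mem_invariants] at hg hh hg' hh'
  rw [map_add, map_add, map_mul, map_mul, refl_X_castSucc, hg, hh, hg', hh'] at e'
  refine sub_eq_zero.mp (eq_zero_of_mul_X_sub_X k (Fin.castSucc_lt_succ (i := i)).ne ?_)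
  linear_combination e - e'

/-- The Demazure operator: `f = g + ∂f x_i` with `g`, `∂f` invariant under `s_i`. -/
noncomputable def demazure (i : Fin n) (f : Poly k n) : Poly k n :=
  (exists_decomp_castSucc k i f).choose_spec.2.choose

theorem demazure_mem (i : Fin n) (f : Poly k n) : demazure k i f ∈ invariants k i :=
  (exists_decomp_castSucc k i f).choose_spec.2.choose_spec.1

theorem demazure_eq {i : Fin n} {f g h : Poly k n} (hg : g ∈ invariants k i)
    (hh : h ∈ invariants k i) (e : f = g + h * X i.castSucc) : demazure k i f = h :=
  castSucc_coeff_unique k (exists_decomp_castSucc k i f).choose_spec.1 (demazure_mem k i f) hg hh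
    ((exists_decomp_castSucc k i f).choose_spec.2.choose_spec.2.symm.trans e)

theorem demazure_add (i : Fin n) (f f' : Poly k n) :
    demazure k i (f + f') = demazure k i f + demazure k i f' := by
  obtain ⟨g, hg, h, hh, rfl⟩ := exists_decomp_castSucc k i f
  obtain ⟨g', hg', h', hh', rfl⟩ := exists_decomp_castSucc k i f'
  rw [demazure_eq k hg hh rfl, demazure_eq k hg' hh' rfl]
  exact demazure_eq k (add_mem hg hg') (add_mem hh hh') (by ring)

theorem demazure_invariant_mul {i : Fin n} {r : Poly k n} (hr : r ∈ invariants k i)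
    (f : Poly k n) : demazure k i (r * f) = r * demazure k i f := by
  obtain ⟨g, hg, h, hh, rfl⟩ := exists_decomp_castSucc k i f
  rw [demazure_eq k hg hh rfl]
  exact demazure_eq k (mul_mem hr hg) (mul_mem hr hh) (by ring)

theorem demazure_of_mem {i : Fin n} {r : Poly k n} (hr : r ∈ invariants k i) :
    demazure k i r = 0 :=
  demazure_eq k hr (zero_mem _) (by ring)

theorem demazure_X_castSucc (i : Fin n) : demazure k i (X i.castSucc) = 1 :=
  demazure_eq k (zero_mem _) (one_mem _) (by ring)

theorem demazure_X_succ (i : Fin n) : demazure k i (X i.succ) = -1 :=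
  demazure_eq k (sum_mem_invariants k i) (neg_mem (one_mem _)) (by ring)

theorem refl_involutive (i : Fin n) (f : Poly k n) : refl k i (refl k i f) = f := by
  rw [refl, rename_rename, ← Equiv.coe_trans, ← Equiv.Perm.mul_def, Equiv.swap_mul_self]
  exact rename_id_apply f

/-- `f = s_i f + (∂_i f) (x_i - x_{i+1})`. -/
theorem eq_refl_add_demazure (i : Fin n) (f : Poly k n) :
    f = refl k i f + demazure k i f * (X i.castSucc - X i.succ) := by
  obtain ⟨g, hg, h, hh, rfl⟩ := exists_decomp_castSucc k i f
  rw [demazure_eq k hg hh rfl, map_add, map_mul, refl_X_castSucc,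
    (mem_invariants k i g).mp hg, (mem_invariants k i h).mp hh]
  ring

/-- The twisted Leibniz rule. After multiplication by the regular element `x_i - x_{i+1}`, each
`∂_i` becomes `f - s_i f` and the identity is formal. -/
theorem demazure_mul (i : Fin n) (r f : Poly k n) :
    demazure k i (r * f) = demazure k i r * refl k i f + r * demazure k i f := by
  refine sub_eq_zero.mp (eq_zero_of_mul_X_sub_X k (Fin.castSucc_lt_succ (i := i)).ne ?_)
  have h1 := eq_refl_add_demazure k i (r * f)
  have h2 := eq_refl_add_demazure k i r
  have h3 := eq_refl_add_demazure k i f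
  rw [map_mul] at h1
  linear_combination (-1 : Poly k n) * h1 + refl k i f * h2 + r * h3

end Polynomials

end

section

variable (k : Type u) [CommRing k] {n : ℕ}

/-! ### Coordinates on `B_i ⊗ M` -/

section Coordinates

open RBimod MvPolynomial

theorem bt_eq_mul (i : Fin n) (f g : Poly k n) : bt k i f g = inclLeft k i f * inclRight k i g := by
  refine Eq.trans ?_ (Algebra.TensorProduct.tmul_mul_tmul (R := invariants k i) f 1 1 g).symm
  rw [one_mul, mul_one]; rfl

/-- The element `f ⊗ g` of the bimodule `B_i`. -/
noncomputable def bs (i : Fin n) (f g : Poly k n) : Bs k i := bt k i f g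

@[elab_as_elim]
theorem bs_induction {i : Fin n} {p : Bs k i → Prop} (x : Bs k i) (h0 : p 0)
    (ht : ∀ f g, p (bs k i f g)) (ha : ∀ x y, p x → p y → p (x + y)) : p x :=
  TensorProduct.induction_on (motive := p) x h0 ht ha

/-- The coordinate `f ⊗ g ↦ s_i(f) g` on `B_i`. -/
noncomputable def coordOne (i : Fin n) : Bs k i →+ Poly k n :=
  TensorProduct.liftAddHom (R := invariants k i) (M := Poly k n) (N := Poly k n)
    (AddMonoidHom.mul.comp (refl k i : Poly k n →+ Poly k n))
    (fun r f g => by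
      change refl k i (r.1 * f) * g = refl k i f * (r.1 * g)
      rw [map_mul, (mem_invariants k i _).mp r.2]
      ring)

/-- The coordinate `f ⊗ g ↦ ∂_i(f) g` on `B_i`. -/
noncomputable def coordDot (i : Fin n) : Bs k i →+ Poly k n :=
  TensorProduct.liftAddHom (R := invariants k i) (M := Poly k n) (N := Poly k n)
    (AddMonoidHom.mul.comp (AddMonoidHom.mk' (demazure k i) (demazure_add k i)))
    (fun r f g => by
      change demazure k i (r.1 * f) * g = demazure k i f * (r.1 * g)
      rw [demazure_invariant_mul k r.2]
      ring)

@[simp] theorem coordOne_bs (i : Fin n) (f g : Poly k n) :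
    coordOne k i (bs k i f g) = refl k i f * g := rfl

@[simp] theorem coordDot_bs (i : Fin n) (f g : Poly k n) :
    coordDot k i (bs k i f g) = demazure k i f * g := rfl

theorem op_smul_bs (i : Fin n) (r f g : Poly k n) :
    op r • bs k i f g = bs k i f (g * r) := op_smul_bt k i r f g

theorem smul_bs (i : Fin n) (r f g : Poly k n) :
    r • bs k i f g = bs k i (r * f) g := smul_bt k i r f g

theorem coordOne_op_smul (i : Fin n) (r : Poly k n) (b : Bs k i) :
    coordOne k i (op r • b) = coordOne k i b * r := by
  induction b using bs_induction with
  | h0 => rw [smul_zero, map_zero, zero_mul]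
  | ht f g => rw [op_smul_bs, coordOne_bs, coordOne_bs, mul_assoc]
  | ha x y hx hy => rw [smul_add, map_add, map_add, hx, hy, add_mul]

theorem coordOne_smul (i : Fin n) (r : Poly k n) (b : Bs k i) :
    coordOne k i (r • b) = refl k i r * coordOne k i b := by
  induction b using bs_induction with
  | h0 => rw [smul_zero, map_zero, mul_zero]
  | ht f g => rw [smul_bs, coordOne_bs, coordOne_bs, map_mul, mul_assoc]
  | ha x y hx hy => rw [smul_add, map_add, map_add, hx, hy, mul_add]

theorem coordDot_op_smul (i : Fin n) (r : Poly k n) (b : Bs k i) :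
    coordDot k i (op r • b) = coordDot k i b * r := by
  induction b using bs_induction with
  | h0 => rw [smul_zero, map_zero, zero_mul]
  | ht f g => rw [op_smul_bs, coordDot_bs, coordDot_bs, mul_assoc]
  | ha x y hx hy => rw [smul_add, map_add, map_add, hx, hy, add_mul]

/-- Together with `coordOne_smul` this says that left multiplication is triangular in the two
coordinates: it acts by `s_i(r)` on the first and by `r` on the second, with `∂_i(r)` as
off-diagonal entry. -/
theorem coordDot_smul (i : Fin n) (r : Poly k n) (b : Bs k i) :
    coordDot k i (r • b) = demazure k i r * coordOne k i b + r * coordDot k i b := by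
  induction b using bs_induction with
  | h0 => rw [smul_zero, map_zero, map_zero, mul_zero, mul_zero, add_zero]
  | ht f g =>
    rw [smul_bs, coordDot_bs, coordDot_bs, coordOne_bs, demazure_mul]
    ring
  | ha x y hx hy =>
    rw [smul_add, map_add, map_add, map_add, hx, hy]
    ring

/-- The element `1 ⊗ 1` of `B_i`. -/
noncomputable def oneElt (i : Fin n) : Bs k i := bs k i 1 1

/-- The element `x_i ⊗ 1 - 1 ⊗ x_{i+1}` of the bimodule `B_i`. -/
noncomputable def dotEl (i : Fin n) : Bs k i := dotElt k i

theorem dotEl_central (i : Fin n) (r : Poly k n) : op r • dotEl k i = r • dotEl k i :=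
  dotElt_central k i r

/-- The source is `f ⊗ 1 = 1 ⊗ s_i(f) + ∂_i(f) (x_i ⊗ 1 - 1 ⊗ x_{i+1})`, so that `1 ⊗ 1` and the dot
span `B_i` as a right module. -/
theorem eq_coord (i : Fin n) (b : Bs k i) :
    b = op (coordOne k i b) • oneElt k i + op (coordDot k i b) • dotEl k i := by
  induction b using bs_induction with
  | h0 => rw [map_zero, map_zero, MulOpposite.op_zero, zero_smul, zero_smul, add_zero]
  | ht f g =>
    rw [coordOne_bs, coordDot_bs]
    refine Eq.trans (b := inclLeft k i f * inclRight k i g) (bt_eq_mul k i f g) ?_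
    change _ = inclRight k i (refl k i f * g) * bt k i 1 1 +
      inclRight k i (demazure k i f * g) * (inclLeft k i (X i.castSucc) - inclRight k i (X i.succ))
    obtain ⟨g₀, hg, h, hh, rfl⟩ := exists_decomp_castSucc k i f
    rw [demazure_eq k hg hh rfl, map_add (refl k i), map_mul (refl k i), refl_X_castSucc,
      (mem_invariants k i g₀).mp hg, (mem_invariants k i h).mp hh, bt_eq_mul]
    simp only [map_add, map_mul, map_one, inclLeft_eq_inclRight k i hg,
      inclLeft_eq_inclRight k i hh]
    ring
  | ha x y hx hy =>
    rw [map_add, map_add, MulOpposite.op_add, MulOpposite.op_add, add_smul, add_smul]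
    nth_rewrite 1 [hx, hy]
    abel

variable {k}
variable {M : RBimod (Poly k n)}

/-- The map `B_i ⊗ M → M` given by a right linear functional on `B_i`. -/
noncomputable def tensCoord (i : Fin n) (M : RBimod (Poly k n)) (c : Bs k i →+ Poly k n)
    (hc : ∀ r b, c (op r • b) = c b * r) : Tens (Bs k i) M →+ M :=
  tensLift (M := Bs k i) (N := M)
    (AddMonoidHom.mk' (fun b => DistribSMul.toAddMonoidHom M (c b)) fun b b' => by
      ext m
      change c (b + b') • m = c b • m + c b' • m
      rw [map_add, add_smul])
    (fun r b m => by
      change c (op r • b) • m = c b • r • m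
      rw [hc, mul_smul])

/-- The coordinate of `B_i ⊗ M` along `1 ⊗ 1`. -/
noncomputable def tensOne (i : Fin n) (M : RBimod (Poly k n)) : Tens (Bs k i) M →+ M :=
  tensCoord i M (coordOne k i) (coordOne_op_smul k i)

/-- The coordinate of `B_i ⊗ M` along `x_i ⊗ 1 - 1 ⊗ x_{i+1}`. -/
noncomputable def tensDot (i : Fin n) (M : RBimod (Poly k n)) : Tens (Bs k i) M →+ M :=
  tensCoord i M (coordDot k i) (coordDot_op_smul k i)

theorem tensOne_tmul (i : Fin n) (b : Bs k i) (m : M) :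
    tensOne i M (tmul b m) = coordOne k i b • m := rfl

theorem tensDot_tmul (i : Fin n) (b : Bs k i) (m : M) :
    tensDot i M (tmul b m) = coordDot k i b • m := rfl

theorem coordOne_oneElt (i : Fin n) : coordOne k i (oneElt k i) = 1 := by
  rw [oneElt, coordOne_bs, map_one, mul_one]

theorem coordDot_oneElt (i : Fin n) : coordDot k i (oneElt k i) = 0 := by
  rw [oneElt, coordDot_bs, demazure_of_mem k (one_mem _), zero_mul]

theorem dotEl_eq (i : Fin n) :
    dotEl k i = bs k i (X i.castSucc) 1 - bs k i 1 (X i.succ) := rfl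

theorem coordOne_dotEl (i : Fin n) : coordOne k i (dotEl k i) = 0 := by
  rw [dotEl_eq, map_sub, coordOne_bs, coordOne_bs, refl_X_castSucc, map_one]
  ring

theorem coordDot_dotEl (i : Fin n) : coordDot k i (dotEl k i) = 1 := by
  rw [dotEl_eq, map_sub, coordDot_bs, coordDot_bs, demazure_X_castSucc,
    demazure_of_mem k (one_mem _)]
  ring

theorem tensOne_smul (i : Fin n) (r : Poly k n) (x : Tens (Bs k i) M) :
    tensOne i M (r • x) = refl k i r • tensOne i M x := by
  induction x using tens_induction with
  | h0 => simp only [smul_zero, map_zero]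
  | ht b m => rw [smul_tmul, tensOne_tmul, tensOne_tmul, coordOne_smul, mul_smul]
  | ha x y hx hy => simp only [smul_add, map_add, hx, hy]

theorem tensOne_op_smul (i : Fin n) (r : Poly k n) (x : Tens (Bs k i) M) :
    tensOne i M (op r • x) = op r • tensOne i M x := by
  induction x using tens_induction with
  | h0 => simp only [smul_zero, map_zero]
  | ht b m => rw [op_smul_tmul, tensOne_tmul, tensOne_tmul, smul_comm]
  | ha x y hx hy => simp only [smul_add, map_add, hx, hy]

theorem tensDot_smul (i : Fin n) (r : Poly k n) (x : Tens (Bs k i) M) :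
    tensDot i M (r • x) = demazure k i r • tensOne i M x + r • tensDot i M x := by
  induction x using tens_induction with
  | h0 => simp only [smul_zero, map_zero, add_zero]
  | ht b m =>
    rw [smul_tmul, tensDot_tmul, tensDot_tmul, tensOne_tmul, coordDot_smul, add_smul, mul_smul,
      mul_smul]
  | ha x y hx hy =>
    simp only [smul_add, map_add, hx, hy]
    abel

theorem tensDot_op_smul (i : Fin n) (r : Poly k n) (x : Tens (Bs k i) M) :
    tensDot i M (op r • x) = op r • tensDot i M x := by
  induction x using tens_induction with
  | h0 => simp only [smul_zero, map_zero]
  | ht b m => rw [op_smul_tmul, tensDot_tmul, tensDot_tmul, smul_comm]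
  | ha x y hx hy => simp only [smul_add, map_add, hx, hy]

theorem eq_tensCoord (i : Fin n) (x : Tens (Bs k i) M) :
    x = tmul (oneElt k i) (tensOne i M x) + tmul (dotEl k i) (tensDot i M x) := by
  induction x using tens_induction with
  | h0 => rw [map_zero, map_zero, tmul_zero, tmul_zero, add_zero]
  | ht b m =>
    rw [tensOne_tmul, tensDot_tmul, ← tmul_balanced, ← tmul_balanced, ← add_tmul, ← eq_coord]
  | ha x y hx hy =>
    rw [map_add, map_add, tmul_add, tmul_add]
    nth_rewrite 1 [hx, hy]
    abel

theorem smul_tmul_dotEl (i : Fin n) (r : Poly k n) (m : M) :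
    r • tmul (dotEl k i) m = tmul (dotEl k i) (r • m) := by
  rw [smul_tmul, ← dotEl_central, tmul_balanced]

/-! ### Central and twisted-central elements of `B_w` -/

/-- An element `v` of `B_w` with `v r = σ(r) v` vanishes if `σ` does not stabilize the set of the
first indices up to `i`, for an `i` that does not occur in `w`. -/
theorem eq_zero_of_twisted (i : Fin n) : ∀ (w : List (Fin n)) (_ : i ∉ w)
    (σ : Equiv.Perm (Fin (n + 1))) (_ : ∃ c, c ≤ i.castSucc ∧ i.castSucc < σ c) (v : BS k w)
    (_ : ∀ r : Poly k n, op r • v = (rename σ r : Poly k n) • v), v = 0 := by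
  intro w
  induction w with
  | nil =>
    rintro - σ ⟨c, hc, hσ⟩ v hv
    have aux : ∀ v : Poly k n, v * X c = X (σ c) * v → v = 0 := fun v h =>
      eq_zero_of_mul_X_sub_X k (hc.trans_lt hσ).ne' (by rw [mul_sub, h, mul_comm, sub_self])
    have := hv (X c)
    rw [rename_X] at this
    exact aux v this
  | cons j w ih =>
    rintro hi σ ⟨c, hc, hσ⟩ v hv
    rw [List.mem_cons, not_or] at hi
    change Tens (Bs k j) (BS k w) at v
    have hv' : ∀ r : Poly k n, op r • v = (rename σ r : Poly k n) • v := hv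
    have h1 : tensOne j (BS k w) v = 0 := by
      -- On the coordinate along `1 ⊗ 1` the twist becomes `s_j σ`. Since `j ≠ i`, the transposition
      -- `s_j` preserves the set of indices beyond the cut at `i`, so the same `c` still crosses it.
      refine ih hi.2 (Equiv.swap j.castSucc j.succ * σ) ⟨c, hc, ?_⟩ _ fun r => ?_
      · rw [Equiv.Perm.mul_apply, Equiv.swap_apply_def]
        have hij : (i : ℕ) ≠ j := fun e => hi.1 (Fin.ext e)
        rw [Fin.lt_def, Fin.val_castSucc] at hσ
        split_ifs with h1 h2
        · rw [h1, Fin.val_castSucc] at hσ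
          rw [Fin.lt_def, Fin.val_castSucc, Fin.val_succ]
          omega
        · rw [h2, Fin.val_succ] at hσ
          rw [Fin.lt_def, Fin.val_castSucc, Fin.val_castSucc]
          omega
        · exact hσ
      · rw [← tensOne_op_smul, hv', tensOne_smul, refl, rename_rename]
        rfl
    have h2 : tensDot j (BS k w) v = 0 := by
      -- With the first coordinate zero, the off-diagonal term disappears and the twist remains `σ`.
      refine ih hi.2 σ ⟨c, hc, hσ⟩ _ fun r => ?_
      rw [← tensDot_op_smul, hv', tensDot_smul, h1, smul_zero, zero_add]
    have := eq_tensCoord j v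
    rw [h1, h2, tmul_zero, tmul_zero, add_zero] at this
    exact this

variable (k) in
/-- The tensor product of the elements `x_i ⊗ 1 - 1 ⊗ x_{i+1}` in `B_w`. -/
noncomputable def dots : ∀ w : List (Fin n), BS k w
  | [] => (1 : Poly k n)
  | i :: w => (tmul (dotEl k i) (dots w) : Tens (Bs k i) (BS k w))

/-- For a word without repetitions, the central elements of `B_w` are the multiples of `dots w`. -/
theorem exists_eq_smul_dots : ∀ (w : List (Fin n)) (_ : w.Nodup) (v : BS k w)
    (_ : ∀ r : Poly k n, op r • v = r • v), ∃ r : Poly k n, v = r • dots k w := by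
  intro w
  induction w with
  | nil =>
    intro _ v _
    exact ⟨(v : Poly k n), (mul_one (show Poly k n from v)).symm⟩
  | cons i w ih =>
    intro hw v hv
    rw [List.nodup_cons] at hw
    change Tens (Bs k i) (BS k w) at v
    have hv' : ∀ r : Poly k n, op r • v = r • v := hv
    have h1 : tensOne i (BS k w) v = 0 := by
      -- For central `v` the first coordinate is twisted by `s_i`, which carries the index of `x_i`
      -- across the cut; `i` does not occur in `w`.
      refine eq_zero_of_twisted i w hw.1 (Equiv.swap i.castSucc i.succ)
        ⟨i.castSucc, le_rfl, ?_⟩ _ fun r => ?_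
      · rw [Equiv.swap_apply_left]
        exact Fin.castSucc_lt_succ
      · rw [← tensOne_op_smul, hv', tensOne_smul]
        rfl
    obtain ⟨r, hr⟩ := ih hw.2 (tensDot i (BS k w) v) fun r => by
      rw [← tensDot_op_smul, hv', tensDot_smul, h1, smul_zero, zero_add]
    refine ⟨r, (eq_tensCoord i v).trans ?_⟩
    rw [h1, tmul_zero, zero_add, hr]
    exact (smul_tmul_dotEl i r (dots k w)).symm

end Coordinates

end

section

variable {k : Type u} [CommRing k] {n : ℕ}

/-! ### Closure properties of the generated morphisms -/

section Generated

open RBimod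

theorem tensorHom_id (v w : List (Fin n)) :
    SC₁.tensorHom k (𝟙 (BS k v)) (𝟙 (BS k w)) = 𝟙 (BS k (v ++ w)) := by
  simp [SC₁.tensorHom]

theorem tensorHom_comp {u v w u' v' w' : List (Fin n)} (f : BS k u ⟶ BS k v)
    (g : BS k v ⟶ BS k w) (f' : BS k u' ⟶ BS k v') (g' : BS k v' ⟶ BS k w') :
    SC₁.tensorHom k (f ≫ g) (f' ≫ g') = SC₁.tensorHom k f f' ≫ SC₁.tensorHom k g g' := by
  simp [SC₁.tensorHom]

theorem tensorMap_add_left {M N P Q : RBimod (Poly k n)} (f g : M ⟶ P) (h : N ⟶ Q) :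
    (f + g) ⊗ₘ h = (f ⊗ₘ h) + (g ⊗ₘ h) :=
  tensor_hom_ext fun m n => add_tmul (f m) (g m) (h n)

theorem tensorMap_add_right {M N P Q : RBimod (Poly k n)} (f : M ⟶ P) (g h : N ⟶ Q) :
    f ⊗ₘ (g + h) = (f ⊗ₘ g) + (f ⊗ₘ h) :=
  tensor_hom_ext fun m n => tmul_add (f m) (g n) (h n)

theorem tensorHom_add_left {v w v' w' : List (Fin n)} (f g : BS k v ⟶ BS k w)
    (h : BS k v' ⟶ BS k w') :
    SC₁.tensorHom k (f + g) h = SC₁.tensorHom k f h + SC₁.tensorHom k g h := by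
  simp [SC₁.tensorHom, tensorMap_add_left]

theorem tensorHom_add_right {v w v' w' : List (Fin n)} (f : BS k v ⟶ BS k w)
    (g h : BS k v' ⟶ BS k w') :
    SC₁.tensorHom k f (g + h) = SC₁.tensorHom k f g + SC₁.tensorHom k f h := by
  simp [SC₁.tensorHom, tensorMap_add_right]

/-- The morphism `1 ⊗ g ⊗ 1`. -/
noncomputable def whisker (u v : List (Fin n)) {a b : List (Fin n)} (g : BS k a ⟶ BS k b) :
    BS k (u ++ (a ++ v)) ⟶ BS k (u ++ (b ++ v)) :=
  SC₁.tensorHom k (𝟙 (BS k u)) (SC₁.tensorHom k g (𝟙 (BS k v)))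

theorem whisker_id (u v a : List (Fin n)) : whisker u v (𝟙 (BS k a)) = 𝟙 _ := by
  rw [whisker, tensorHom_id, tensorHom_id]

theorem whisker_comp (u v : List (Fin n)) {a b c : List (Fin n)} (g : BS k a ⟶ BS k b)
    (h : BS k b ⟶ BS k c) : whisker u v (g ≫ h) = whisker u v g ≫ whisker u v h := by
  rw [whisker, whisker, whisker, ← tensorHom_comp, ← tensorHom_comp, Category.comp_id,
    Category.comp_id]

theorem whisker_add (u v : List (Fin n)) {a b : List (Fin n)} (g h : BS k a ⟶ BS k b) :
    whisker u v (g + h) = whisker u v g + whisker u v h := by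
  rw [whisker, tensorHom_add_left, tensorHom_add_right]
  rfl

theorem Generated.whisker {D : HeckeChoice k n} (u v : List (Fin n)) {a b : List (Fin n)}
    {g : BS k a ⟶ BS k b} (hg : Generated D g) : Generated D (whisker u v g) :=
  (Generated.id u).tensor (hg.tensor (Generated.id v))

/-- All morphisms from `B_v` to `B_w` are generated. -/
def Full (D : HeckeChoice k n) (v w : List (Fin n)) : Prop :=
  ∀ f : BS k v ⟶ BS k w, Generated D f

variable {D : HeckeChoice k n}

/-- If the identity of `B_a` factors through `B_b` and `B_c`, with generated morphisms to `B_a`,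
then all morphisms to `B_{u a v}` are generated if all morphisms to `B_{u b v}` and `B_{u c v}` are. -/
theorem Full.of_retract {x u v a b c : List (Fin n)} {g : BS k a ⟶ BS k b} {h : BS k b ⟶ BS k a}
    {g' : BS k a ⟶ BS k c} {h' : BS k c ⟶ BS k a} (e : g ≫ h + g' ≫ h' = 𝟙 (BS k a))
    (hh : Generated D h) (hh' : Generated D h') (hb : Full D x (u ++ (b ++ v)))
    (hc : Full D x (u ++ (c ++ v))) : Full D x (u ++ (a ++ v)) := by
  intro f
  -- Only the maps back into `B_a` have to be generated, because the composites in parentheses lie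
  -- in Hom sets that are already covered.
  have : f = (f ≫ whisker u v g) ≫ whisker u v h + (f ≫ whisker u v g') ≫ whisker u v h' := by
    rw [Category.assoc, Category.assoc, ← Preadditive.comp_add, ← whisker_comp, ← whisker_comp,
      ← whisker_add, e, whisker_id, Category.comp_id]
  rw [this]
  exact ((hb _).comp (hh.whisker u v)).add ((hc _).comp (hh'.whisker u v))

theorem Full.of_iso {x u v a b : List (Fin n)} {g : BS k a ⟶ BS k b} {h : BS k b ⟶ BS k a}
    (e : g ≫ h = 𝟙 (BS k a)) (hh : Generated D h) (hb : Full D x (u ++ (b ++ v))) :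
    Full D x (u ++ (a ++ v)) :=
  Full.of_retract (g := g) (h := h) (g' := 0) (h' := h) (by simpa using e) hh hh hb hb

/-- Inserting `biprod.total` between a chosen isomorphism and its inverse factors an identity
through the summands. For `j i j` the identity is restricted to one summand of its side of the braid
relation, giving `i j i` and `j`. -/
theorem Full.locallyReducible (x : List (Fin n)) : LocallyReducible (Full D x) where
  square u v i h := by
    refine Full.of_retract (a := [i, i]) (b := [i]) (c := [i]) ?_ (.of (.square_inl i))
      (.of (.square_inr i)) (g := (BS₂ k i i).hom ≫ ((D.square i).hom ≫ biprod.fst) ≫ (BS₁ k i).inv)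
      (g' := (BS₂ k i i).hom ≫ ((D.square i).hom ≫ biprod.snd) ≫ (BS₁ k i).inv) h h
    have := biprod.total (X := Bs k i) (Y := Bs k i)
    simp only [Category.assoc, Iso.inv_hom_id_assoc]
    rw [← Preadditive.comp_add, ← Preadditive.comp_add]
    rw [← Category.assoc biprod.fst, ← Category.assoc biprod.snd, ← Preadditive.add_comp, this]
    simp
  distant u v i j hij h := by
    refine Full.of_iso (a := [i, j]) (b := [j, i]) ?_ (.of (.distant_inv i j hij))
      (g := (BS₂ k i j).hom ≫ (D.distant i j hij).hom ≫ (BS₂ k j i).inv) h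
    simp
  braid u v i j hij h h' := by
    refine Full.of_retract (a := [j, i, j]) (b := [i, j, i]) (c := [j]) ?_
      (.of (.braid_hom_inl_fst i j hij)) (.of (.braid_hom_inr_fst i j hij))
      (g := (BS₃ k j i j).hom ≫ (biprod.inl ≫ (D.braid i j hij).inv ≫ biprod.fst) ≫
        (BS₃ k i j i).inv)
      (g' := (BS₃ k j i j).hom ≫ (biprod.inl ≫ (D.braid i j hij).inv ≫ biprod.snd) ≫
        (BS₁ k j).inv) h h'
    have := biprod.total (X := Bs k i ⊗ Bs k j ⊗ Bs k i) (Y := Bs k j)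
    simp only [Category.assoc, Iso.inv_hom_id_assoc]
    rw [← Preadditive.comp_add, ← Preadditive.comp_add, ← Preadditive.comp_add]
    rw [← Category.assoc biprod.fst, ← Category.assoc biprod.snd, ← Preadditive.add_comp, this]
    simp

/-! ### Moving tensor factors by duality -/

theorem tensorHom_id_singleton (i : Fin n) {v w : List (Fin n)} (g : BS k v ⟶ BS k w) :
    SC₁.tensorHom k (𝟙 (BS k [i])) g = (Bs k i ◁ g : Bs k i ⊗ BS k v ⟶ Bs k i ⊗ BS k w) := by
  refine tensor_hom_ext fun b x => ?_
  change tmul b ((1 : Poly k n) • g x) = tmul b (g x)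
  rw [one_smul]

theorem tensorHom_counit_id (D : HeckeChoice k n) (i : Fin n) (v : List (Fin n)) :
    SC₁.tensorHom k (v := [i, i]) (w := []) ((BS₂ k i i).hom ≫ (D.selfDual i).evaluation')
      (𝟙 (BS k v)) =
    ((α_ _ _ _).inv ≫ (D.selfDual i).evaluation' ▷ BS k v ≫ (λ_ (BS k v)).hom :
      Bs k i ⊗ Bs k i ⊗ BS k v ⟶ BS k v) := by
  refine (cancel_epi (α_ (Bs k i) (Bs k i) (BS k v)).hom).mp ?_
  refine tensor_hom_ext₃ fun b b' x => ?_
  change (show Poly k n from (D.selfDual i).evaluation' (tmul b (op (1 : Poly k n) • b'))) • x =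
    (show Poly k n from (D.selfDual i).evaluation' (tmul b b')) • x
  rw [MulOpposite.op_one, one_smul]

/-- The adjunction given by self-duality: `f` is recovered from its mate `g : B_v ⟶ B_i ⊗ B_w` as `1
⊗ g` followed by a counit. -/
theorem Full.transpose {i : Fin n} {v w : List (Fin n)} (h : Full D v (i :: w)) :
    Full D (i :: v) w := by
  intro f
  let _ := D.selfDual i
  let g : BS k v ⟶ Bs k i ⊗ BS k w := tensorLeftHomEquiv (BS k v) (Bs k i) (Bs k i) (BS k w) f
  have e : f = SC₁.tensorHom k (𝟙 (BS k [i])) (show BS k v ⟶ BS k (i :: w) from g) ≫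
      SC₁.tensorHom k (v := [i, i]) (w := []) ((BS₂ k i i).hom ≫ (D.selfDual i).evaluation')
        (𝟙 (BS k w)) := by
    rw [tensorHom_id_singleton, tensorHom_counit_id]
    exact ((tensorLeftHomEquiv (BS k v) (Bs k i) (Bs k i) (BS k w)).symm_apply_apply f).symm
  rw [e]
  exact ((Generated.id [i]).tensor (h g)).comp ((Generated.of (.counit i)).tensor (.id w))

/-- Both sides send `b ⊗ b'` to `g(1 ⊗ b) ⊗ b'`. This matches `SC₁.tensorHom`, with its
concatenations, to the form in which the right-hand adjunction appears. -/
theorem pair_tensorHom (i : Fin n) {w : List (Fin n)} (g : 𝟙_ _ ⊗ Bs k i ⟶ BS k w) :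
    (BS₂ k i i).inv ≫ SC₁.tensorHom k (v := [i]) (v' := [i])
        ((BS₁ k i).hom ≫ (λ_ (Bs k i)).inv ≫ g) (𝟙 (BS k [i])) ≫
      (BSappend k w [i]).hom ≫ BS k w ◁ (BS₁ k i).hom =
    (λ_ (Bs k i ⊗ Bs k i)).inv ≫ (α_ _ _ _).inv ≫ g ▷ Bs k i := by
  rw [SC₁.tensorHom, Category.assoc, Category.assoc, Iso.inv_hom_id_assoc]
  refine tensor_hom_ext fun b b' => ?_
  change tmul (g (tmul (M := 𝟙_ (RBimod (Poly k n))) (1 : Poly k n) (op (1 : Poly k n) • b)))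
      (op (1 : Poly k n) • b') =
    tmul (g (tmul (M := 𝟙_ (RBimod (Poly k n))) (1 : Poly k n) b)) b'
  rw [MulOpposite.op_one, one_smul, one_smul]

/-- By transposition, the hypothesis covers all `B_i ⟶ B_w`. The adjunction on the other side writes
`R ⟶ B_w ⊗ B_i` as a unit followed by such a morphism tensored with the identity of `B_i`. -/
theorem Full.rotate {i : Fin n} {w : List (Fin n)} (h : Full D [] (i :: w)) :
    Full D [] (w ++ [i]) := by
  intro f
  let _ := D.selfDual i
  let g : BS k [i] ⟶ BS k w := (BS₁ k i).hom ≫ (λ_ (Bs k i)).inv ≫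
    (tensorRightHomEquiv (𝟙_ _) (Bs k i) (Bs k i) (BS k w)).symm
      (f ≫ (BSappend k w [i]).hom ≫ BS k w ◁ (BS₁ k i).hom)
  have e : f = (show BS k [] ⟶ BS k [i, i] from
      (D.selfDual i).coevaluation' ≫ (BS₂ k i i).inv) ≫
      SC₁.tensorHom k (v := [i]) g (𝟙 (BS k [i])) := by
    have := (tensorRightHomEquiv (𝟙_ _) (Bs k i) (Bs k i) (BS k w)).apply_symm_apply
      (f ≫ (BSappend k w [i]).hom ≫ BS k w ◁ (BS₁ k i).hom)
    refine (cancel_mono ((BSappend k w [i]).hom ≫ BS k w ◁ (BS₁ k i).hom)).mp (this.symm.trans ?_)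
    refine Eq.trans ?_ ((congrArg ((D.selfDual i).coevaluation' ≫ ·) (pair_tensorHom i _)).symm.trans
      (by simp only [Category.assoc]; rfl))
    change (ρ_ _).inv ≫ _ ◁ (D.selfDual i).coevaluation' ≫ (α_ _ _ _).inv ≫ _ ▷ _ = _
    rw [leftUnitor_inv_naturality_assoc, unitors_inv_equal]
  rw [e]
  exact (Generated.of (.unit i)).comp ((h.transpose g).tensor (.id [i]))

/-! ### Morphisms out of `R`, and the general case -/

theorem generated_dots (D : HeckeChoice k n) : ∀ w : List (Fin n),
    ∃ f : BS k [] ⟶ BS k w, Generated D f ∧ f (1 : Poly k n) = dots k w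
  | [] => ⟨𝟙 _, .id _, rfl⟩
  | i :: w => by
    obtain ⟨f, hf, hf1⟩ := generated_dots D w
    refine ⟨_, (Generated.of (.dot i)).tensor hf, ?_⟩
    have : SC₁.tensorHom k (v := []) (w := [i]) (dot k i ≫ (BS₁ k i).inv) f (1 : Poly k n) =
      tmul ((1 : Poly k n) • dotEl k i) ((1 : Poly k n) • f (1 : Poly k n)) := rfl
    refine this.trans ?_
    rw [one_smul, one_smul, hf1]
    rfl

/-- A morphism out of `R` is determined by the image of `1`, which is central, hence a left multiple
of `dots w`. -/
theorem Full.of_nodup {w : List (Fin n)} (hw : w.Nodup) : Full D [] w := by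
  intro f
  obtain ⟨g, hg, hg1⟩ := generated_dots D w
  let e : BS k (n := n) [] := (1 : Poly k n)
  have he : ∀ r : Poly k n, op r • e = r • e := fun r => by
    change (1 : Poly k n) * r = r * 1
    rw [mul_comm]
  have he' : ∀ s : BS k (n := n) [], s = (show Poly k n from s) • e := fun s =>
    (mul_one (show Poly k n from s)).symm
  obtain ⟨r, hr⟩ := exists_eq_smul_dots w hw (f e) fun r => by
    rw [← map_op, ← map_left, he]
  have : f = r • g := by
    refine hom_ext fun s => ?_
    rw [RBimod.smul_apply, he' s, map_left, map_left, hr, ← hg1, smul_comm]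
  rw [this]
  exact hg.smul r

theorem full (D : HeckeChoice k n) : ∀ v w : List (Fin n), Full D v w
  | [], w => (Full.locallyReducible []).forall_of_nodup (fun _ _ h => h.rotate)
      (fun _ h => .of_nodup h) w
  | i :: v, w => (full D v (i :: w)).transpose

end Generated

end

section

/-! ### Ranks of bimodules -/

section Rank

open RBimod

variable {R : Type u} [CommRing R]

/-- `M` is generated by `m` elements as a left module. -/
def GeneratedBy (M : RBimod R) (m : ℕ) : Prop :=
  ∃ v : Fin m → M, Submodule.span R (Set.range v) = ⊤

/-- `M` is a free left module of rank `m`. -/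
def FreeOfRank (M : RBimod R) (m : ℕ) : Prop := Nonempty (Module.Basis (Fin m) R M)

theorem FreeOfRank.generatedBy {M : RBimod R} {m : ℕ} (h : FreeOfRank M m) : GeneratedBy M m :=
  h.elim fun b => ⟨b, b.span_eq⟩

theorem FreeOfRank.of_iso {M N : RBimod R} {m : ℕ} (h : FreeOfRank M m) (e : M ≅ N) :
    FreeOfRank N m :=
  h.elim fun b => ⟨b.map
    { e.hom.toLin with
      invFun := e.inv
      left_inv := fun x => DFunLike.congr_fun e.hom_inv_id x
      right_inv := fun x => DFunLike.congr_fun e.inv_hom_id x }⟩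

theorem GeneratedBy.biprod {M N : RBimod R} {m l : ℕ} (hM : GeneratedBy M m)
    (hN : GeneratedBy N l) : GeneratedBy (M ⊞ N) (m + l) := by
  obtain ⟨v, hv⟩ := hM
  obtain ⟨w, hw⟩ := hN
  refine ⟨Sum.elim (fun a => (biprod.inl : M ⟶ M ⊞ N) (v a))
    (fun a => (biprod.inr : N ⟶ M ⊞ N) (w a)) ∘ finSumFinEquiv.symm, ?_⟩
  rw [EquivLike.range_comp, Set.Sum.elim_range, eq_top_iff]
  intro x _
  have hx : x = (biprod.inl : M ⟶ M ⊞ N) ((biprod.fst : M ⊞ N ⟶ M) x) +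
      (biprod.inr : N ⟶ M ⊞ N) ((biprod.snd : M ⊞ N ⟶ N) x) :=
    (DFunLike.congr_fun (biprod.total (X := M) (Y := N)) x).symm
  rw [hx, Submodule.span_union]
  refine Submodule.add_mem_sup ?_ ?_
  · have : (biprod.fst : M ⊞ N ⟶ M) x ∈ Submodule.span R (Set.range v) := hv ▸ trivial
    have := Submodule.mem_map_of_mem (f := (biprod.inl : M ⟶ M ⊞ N).toLin) this
    rw [Submodule.map_span, ← Set.range_comp] at this
    exact this
  · have : (biprod.snd : M ⊞ N ⟶ N) x ∈ Submodule.span R (Set.range w) := hw ▸ trivial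
    have := Submodule.mem_map_of_mem (f := (biprod.inr : N ⟶ M ⊞ N).toLin) this
    rw [Submodule.map_span, ← Set.range_comp] at this
    exact this

/-- A bijective homomorphism of bimodules is an isomorphism. -/
theorem isIso_of_bijective {M N : RBimod R} (f : M ⟶ N) (hf : Function.Bijective f) : IsIso f := by
  let e := Equiv.ofBijective f hf
  have he : ∀ x, f (e.symm x) = x := e.apply_symm_apply
  refine ⟨mkHom (AddMonoidHom.mk' e.symm fun x y => hf.1 ?_) (fun r x => hf.1 ?_)
    (fun r x => hf.1 ?_), hom_ext fun x => e.symm_apply_apply x, hom_ext he⟩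
  · exact (he _).trans ((map_add f _ _).trans (congrArg₂ _ (he x) (he y))).symm
  · change f (e.symm _) = f (r • e.symm _)
    rw [map_left, he, he]
  · change f (e.symm _) = f (op r • e.symm _)
    rw [map_op, he, he]

/-- A surjection from a bimodule generated by `m` elements to a free one of rank `m` is an
isomorphism. -/
theorem isIso_of_surjective {M N : RBimod R} {m : ℕ} (hM : GeneratedBy M m) (hN : FreeOfRank N m)
    (f : M ⟶ N) (hf : Function.Surjective f) : IsIso f := by
  obtain ⟨v, hv⟩ := hM
  obtain ⟨b⟩ := hN
  refine isIso_of_bijective f ⟨?_, hf⟩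
  let p : (Fin m → R) →ₗ[R] M := Fintype.linearCombination R v
  have hp : Function.Surjective p := by
    rw [← LinearMap.range_eq_top, Fintype.range_linearCombination, hv]
  let q : (Fin m → R) →ₗ[R] (Fin m → R) := b.equivFun.toLinearMap ∘ₗ f.toLin ∘ₗ p
  have hq : Function.Injective q :=
    OrzechProperty.injective_of_surjective_endomorphism q
      (b.equivFun.surjective.comp (hf.comp hp))
  intro x y hxy
  obtain ⟨a, rfl⟩ := hp x
  obtain ⟨c, rfl⟩ := hp y
  have : q a = q c := congrArg b.equivFun hxy
  rw [hq this]

/-- An additive subgroup of a bimodule that is stable under both actions. -/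
structure IsSubbimodule {M : RBimod R} (T : AddSubgroup M) : Prop where
  smul_mem (r : R) {x : M} : x ∈ T → r • x ∈ T
  op_smul_mem (r : R) {x : M} : x ∈ T → op r • x ∈ T

/-- The image of a homomorphism of bimodules. -/
def image {M N : RBimod R} (f : M ⟶ N) : AddSubgroup N := AddMonoidHom.range (f : M →+ N)

theorem mem_image {M N : RBimod R} (f : M ⟶ N) (x : M) : f x ∈ image f := ⟨x, rfl⟩

theorem mem_image_of_comp {L M N : RBimod R} (g : L ⟶ M) (f : M ⟶ N) (x : L) :
    (g ≫ f) x ∈ image f := ⟨g x, rfl⟩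

theorem surjective_of_image {M N : RBimod R} {f : M ⟶ N} (h : image f = ⊤) :
    Function.Surjective f := AddMonoidHom.range_eq_top.mp h

theorem isSubbimodule_image {M N : RBimod R} (f : M ⟶ N) : IsSubbimodule (image f) where
  smul_mem r := by
    rintro _ ⟨x, rfl⟩
    exact ⟨r • x, map_left f r x⟩
  op_smul_mem r := by
    rintro _ ⟨x, rfl⟩
    exact ⟨op r • x, map_op f r x⟩

end Rank

variable (k : Type u) [CommRing k] {n : ℕ}

/-! ### Left bases of `B_i ⊗ M` -/

section Free

open RBimod

variable {k}

theorem smul_tmul_oneElt {M : RBimod (Poly k n)} (i : Fin n) (r : Poly k n) (m : M) :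
    r • tmul (oneElt k i) m =
      tmul (oneElt k i) (refl k i r • m) + tmul (dotEl k i) (demazure k i r • m) := by
  rw [eq_tensCoord i (r • tmul (oneElt k i) m), tensOne_smul, tensDot_smul, tensOne_tmul,
    tensDot_tmul, coordOne_oneElt, coordDot_oneElt, one_smul, zero_smul, smul_zero, add_zero]

/-- The coordinates are only triangular for the left action. Independence is therefore read off
first from `tensOne`, up to the bijection `s_i`, and then from `tensDot`. -/
theorem FreeOfRank.tensor {M : RBimod (Poly k n)} {m : ℕ} (h : FreeOfRank M m) (i : Fin n) :
    FreeOfRank (Bs k i ⊗ M) (m + m) := by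
  obtain ⟨b⟩ := h
  let v : Fin m ⊕ Fin m → Tens (Bs k i) M :=
    Sum.elim (fun a => tmul (oneElt k i) (b a)) (fun a => tmul (dotEl k i) (b a))
  have hli : LinearIndependent (Poly k n) v := by
    rw [Fintype.linearIndependent_iff]
    intro g hg
    rw [Fintype.sum_sum_type] at hg
    simp only [v, Sum.elim_inl, Sum.elim_inr] at hg
    have h0 : ∀ a, tensOne i M (tmul (dotEl k i) (b a)) = 0 := fun a => by
      rw [tensOne_tmul, coordOne_dotEl, zero_smul]
    have h1 : ∀ a, g (Sum.inl a) = 0 := by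
      have := congrArg (tensOne i M) hg
      rw [map_add, map_sum, map_sum, map_zero] at this
      simp only [tensOne_smul, h0, smul_zero, Finset.sum_const_zero, add_zero, tensOne_tmul,
        coordOne_oneElt, one_smul] at this
      intro a
      have := Fintype.linearIndependent_iff.mp b.linearIndependent _ this a
      rw [← refl_involutive k i (g (Sum.inl a)), this, map_zero]
    have h2 : ∀ a, g (Sum.inr a) = 0 := by
      have := congrArg (tensDot i M) hg
      rw [map_add, map_sum, map_sum, map_zero] at this
      simp only [h1, zero_smul, map_zero, Finset.sum_const_zero, zero_add, tensDot_smul, h0,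
        smul_zero, tensDot_tmul, coordDot_dotEl, one_smul] at this
      exact Fintype.linearIndependent_iff.mp b.linearIndependent _ this
    rintro (a | a)
    exacts [h1 a, h2 a]
  have hdot : ∀ m : M, tmul (dotEl k i) m ∈ Submodule.span (Poly k n) (Set.range v) := by
    intro m
    induction b.mem_span m using Submodule.span_induction with
    | mem x hx =>
      obtain ⟨a, rfl⟩ := hx
      exact Submodule.subset_span ⟨Sum.inr a, rfl⟩
    | zero => rw [tmul_zero]; exact zero_mem _
    | add x y _ _ hx hy => rw [tmul_add]; exact add_mem hx hy
    | smul r x _ hx => rw [← smul_tmul_dotEl]; exact Submodule.smul_mem _ r hx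
  have hone : ∀ m : M, tmul (oneElt k i) m ∈ Submodule.span (Poly k n) (Set.range v) := by
    intro m
    induction b.mem_span m using Submodule.span_induction with
    | mem x hx =>
      obtain ⟨a, rfl⟩ := hx
      exact Submodule.subset_span ⟨Sum.inl a, rfl⟩
    | zero => rw [tmul_zero]; exact zero_mem _
    | add x y _ _ hx hy => rw [tmul_add]; exact add_mem hx hy
    | smul r x _ hx =>
      -- Acting by `s_i(r)` turns `1 ⊗ 1 ⊗ x` into `1 ⊗ 1 ⊗ r x` plus a term along the dot, which is
      -- already in the span.
      have := smul_tmul_oneElt i (refl k i r) x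
      rw [refl_involutive] at this
      rw [← sub_eq_iff_eq_add.mpr this]
      exact sub_mem (Submodule.smul_mem _ _ hx) (hdot _)
  have hsp : ⊤ ≤ Submodule.span (Poly k n) (Set.range v) := fun x _ => by
    rw [eq_tensCoord i x]
    exact add_mem (hone _) (hdot _)
  exact ⟨(Module.Basis.mk hli hsp).reindex finSumFinEquiv⟩

theorem freeOfRank_unit : FreeOfRank (𝟙_ (RBimod (Poly k n))) 1 :=
  ⟨Module.Basis.singleton (Fin 1) (Poly k n)⟩

theorem freeOfRank_Bs (i : Fin n) : FreeOfRank (Bs k i) 2 :=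
  (freeOfRank_unit.tensor i).of_iso (ρ_ (Bs k i))

end Free

/-! ### The bimodules `R ⊗_S R` -/

section Induced

open RBimod

variable {k} (S : Subalgebra k (Poly k n))

/-- The ring `R ⊗_S R`. -/
def InducedCarrier : Type u := Poly k n ⊗[S] Poly k n

noncomputable instance : CommRing (InducedCarrier S) :=
  inferInstanceAs (CommRing (Poly k n ⊗[S] Poly k n))

/-- `f ↦ f ⊗ 1`. -/
noncomputable def inducedLeft : Poly k n →+* InducedCarrier S :=
  (Algebra.TensorProduct.includeLeft (R := S) (S := S) (A := Poly k n) (B := Poly k n)).toRingHom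

/-- `g ↦ 1 ⊗ g`. -/
noncomputable def inducedRight : Poly k n →+* InducedCarrier S :=
  (Algebra.TensorProduct.includeRight (R := S) (A := Poly k n) (B := Poly k n)).toRingHom

noncomputable instance : Module (Poly k n) (InducedCarrier S) :=
  Module.compHom (InducedCarrier S) (inducedLeft S)

noncomputable instance : Module (Poly k n)ᵐᵒᵖ (InducedCarrier S) :=
  Module.compHom (InducedCarrier S)
    ((inducedRight S).comp (RingEquiv.toOpposite (Poly k n)).symm.toRingHom)

instance : SMulCommClass (Poly k n) (Poly k n)ᵐᵒᵖ (InducedCarrier S) where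
  smul_comm r s x := mul_left_comm (inducedLeft S r) (inducedRight S s.unop) x

/-- The bimodule `R ⊗_S R`. -/
noncomputable def induced : RBimod (Poly k n) where
  carrier := InducedCarrier S

/-- The element `f ⊗ g` of `R ⊗_S R`. -/
noncomputable def it (f g : Poly k n) : induced S :=
  show Poly k n ⊗[S] Poly k n from f ⊗ₜ[S] g

@[elab_as_elim]
theorem induced_induction {p : induced S → Prop} (x : induced S) (h0 : p 0)
    (ht : ∀ f g, p (it S f g)) (ha : ∀ x y, p x → p y → p (x + y)) : p x :=
  TensorProduct.induction_on (motive := p) x h0 ht ha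

theorem smul_it (r f g : Poly k n) : r • it S f g = it S (r * f) g := by
  refine (Algebra.TensorProduct.tmul_mul_tmul (R := S) r f 1 g).trans ?_
  rw [one_mul]; rfl

theorem op_smul_it (r f g : Poly k n) : op r • it S f g = it S f (g * r) := by
  refine (Algebra.TensorProduct.tmul_mul_tmul (R := S) 1 f r g).trans ?_
  rw [one_mul, mul_comm]; rfl

theorem it_balanced (r : S) (f g : Poly k n) : it S (r * f) g = it S f (r * g) :=
  TensorProduct.smul_tmul (R := S) r f g

theorem it_sum {ι : Type*} (s : Finset ι) (f : Poly k n) (g : ι → Poly k n) :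
    it S f (∑ a ∈ s, g a) = ∑ a ∈ s, it S f (g a) :=
  TensorProduct.tmul_sum (R := S) f s g

variable {S}

/-- The additive map on `R ⊗_S R` given by an `S`-balanced map. -/
noncomputable def inducedLift {A : Type*} [AddCommGroup A] (F : Poly k n →+ Poly k n →+ A)
    (hF : ∀ (r : S) (f g : Poly k n), F (r * f) g = F f (r * g)) : induced S →+ A :=
  TensorProduct.liftAddHom (R := S) (M := Poly k n) (N := Poly k n) F hF

theorem inducedLift_it {A : Type*} [AddCommGroup A] (F : Poly k n →+ Poly k n →+ A)
    (hF : ∀ (r : S) (f g : Poly k n), F (r * f) g = F f (r * g)) (f g : Poly k n) :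
    inducedLift F hF (it S f g) = F f g := rfl

/-- The biadditive map `(f, g) ↦ f v g`. -/
noncomputable def biAct {M : RBimod (Poly k n)} (v : M) : Poly k n →+ Poly k n →+ M :=
  AddMonoidHom.mk' (fun f => AddMonoidHom.mk' (fun g => f • op g • v) fun g g' => by
      rw [MulOpposite.op_add, add_smul, smul_add])
    fun f f' => AddMonoidHom.ext fun g => add_smul f f' (op g • v : M)

theorem biAct_apply {M : RBimod (Poly k n)} (v : M) (f g : Poly k n) :
    biAct v f g = f • op g • v := rfl

/-- The homomorphism `f ⊗ g ↦ f v g` attached to an element `v` that commutes with `S`. -/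
noncomputable def inducedDesc {M : RBimod (Poly k n)} (v : M)
    (hv : ∀ r ∈ S, op r • v = r • v) : induced S ⟶ M :=
  mkHom (inducedLift (biAct v) (fun r f g => by
        rw [biAct_apply, biAct_apply, mul_comm, mul_smul, MulOpposite.op_mul, mul_smul, hv _ r.2,
          smul_comm (r : Poly k n) (op g)]))
    (fun r x => by
      induction x using induced_induction with
      | h0 => rw [smul_zero, map_zero, smul_zero]
      | ht f g => rw [smul_it, inducedLift_it, inducedLift_it, biAct_apply, biAct_apply, mul_smul]
      | ha x y hx hy => rw [smul_add, map_add, map_add, hx, hy, smul_add])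
    (fun r x => by
      induction x using induced_induction with
      | h0 => rw [smul_zero, map_zero, smul_zero]
      | ht f g =>
        rw [op_smul_it, inducedLift_it, inducedLift_it, biAct_apply, biAct_apply,
          MulOpposite.op_mul, mul_smul, smul_comm f]
      | ha x y hx hy => rw [smul_add, map_add, map_add, hx, hy, smul_add])

theorem inducedDesc_it {M : RBimod (Poly k n)} (v : M) (hv : ∀ r ∈ S, op r • v = r • v)
    (f g : Poly k n) : inducedDesc v hv (it S f g) = f • op g • v := rfl

theorem inducedDesc_one {M : RBimod (Poly k n)} (v : M) (hv : ∀ r ∈ S, op r • v = r • v) :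
    inducedDesc v hv (it S 1 1) = v := by
  rw [inducedDesc_it, MulOpposite.op_one, one_smul, one_smul]

/-- If the `g a` span `R` over `S`, the elements `1 ⊗ g a` span on the left, because coefficients in
`S` cross the tensor sign. -/
theorem generatedBy_induced {m : ℕ} (g : Fin m → Poly k n)
    (hg : ∀ f : Poly k n, ∃ c : Fin m → S, f = ∑ a, (c a : Poly k n) * g a) :
    GeneratedBy (induced S) m := by
  refine ⟨fun a => it S 1 (g a), ?_⟩
  rw [eq_top_iff]
  intro x _
  induction x using induced_induction with
  | h0 => exact zero_mem _
  | ht f f' =>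
    obtain ⟨c, rfl⟩ := hg f'
    rw [it_sum]
    refine sum_mem fun a _ => ?_
    have : it S f (c a * g a) = (c a * f : Poly k n) • it S 1 (g a) := by
      rw [smul_it, mul_one, it_balanced]
    rw [this]
    exact Submodule.smul_mem _ _ (Submodule.subset_span ⟨a, rfl⟩)
  | ha x y hx hy => exact add_mem (hx trivial) (hy trivial)

variable (k)

/-- The homomorphism `B_i ⟶ M`, `f ⊗ g ↦ f v g`. -/
noncomputable def bsDesc {i : Fin n} {M : RBimod (Poly k n)} (v : M)
    (hv : ∀ r ∈ invariants k i, op r • v = r • v) : Bs k i ⟶ M :=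
  inducedDesc v hv

theorem bsDesc_bs {i : Fin n} {M : RBimod (Poly k n)} (v : M)
    (hv : ∀ r ∈ invariants k i, op r • v = r • v) (f g : Poly k n) :
    bsDesc k v hv (bs k i f g) = f • op g • v := rfl

theorem bsDesc_one {i : Fin n} {M : RBimod (Poly k n)} (v : M)
    (hv : ∀ r ∈ invariants k i, op r • v = r • v) : bsDesc k v hv (oneElt k i) = v := by
  rw [oneElt, bsDesc_bs, MulOpposite.op_one, one_smul, one_smul]

theorem bs_eq (i : Fin n) (f g : Poly k n) : bs k i f g = f • op g • oneElt k i := by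
  rw [oneElt, op_smul_bs, smul_bs, mul_one, one_mul]

theorem bs_hom_ext {i : Fin n} {M : RBimod (Poly k n)} {f g : Bs k i ⟶ M}
    (h : f (oneElt k i) = g (oneElt k i)) : f = g := hom_ext fun x => by
  induction x using bs_induction with
  | h0 => rw [map_zero, map_zero]
  | ht p q => rw [bs_eq, map_left, map_left, map_op, map_op, h]
  | ha x y hx hy => rw [map_add, map_add, hx, hy]

theorem oneElt_comm {i : Fin n} {r : Poly k n} (hr : r ∈ invariants k i) :
    op r • oneElt k i = r • oneElt k i :=
  (inclLeft_eq_inclRight k i hr ▸ rfl : inclRight k i r * bt k i 1 1 = inclLeft k i r * bt k i 1 1)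

end Induced

end

section

variable (k : Type u) [CommRing k] {n : ℕ}

/-! ### Generators of the polynomial ring over rings of invariants -/

section Generators

open MvPolynomial RBimod

/-- The pairs of variables moved by `s_i` and `s_j` are disjoint, so the two quadratic relations are
independent of each other and `1, a, b, ab` span. Spanning suffices, as injectivity comes from the
rank count. -/
theorem generatedBy_induced_distant {i j : Fin n} (h : (i : ℕ) + 2 ≤ j ∨ (j : ℕ) + 2 ≤ i) :
    GeneratedBy (induced (invariants k i ⊓ invariants k j)) 4 := by
  have hne : i.castSucc ≠ j.castSucc ∧ i.castSucc ≠ j.succ ∧ i.succ ≠ j.castSucc ∧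
      i.succ ≠ j.succ := by
    simp only [ne_eq, Fin.ext_iff, Fin.val_castSucc, Fin.val_succ]
    omega
  let S := invariants k i ⊓ invariants k j
  have hXi := X_mem_invariants k j hne.1 hne.2.1
  have hXi' := X_mem_invariants k j hne.2.2.1 hne.2.2.2
  have hXj := X_mem_invariants k i hne.1.symm hne.2.2.1.symm
  have hXj' := X_mem_invariants k i hne.2.1.symm hne.2.2.2.symm
  let s : S := ⟨_, sum_mem_invariants k i, add_mem hXi hXi'⟩
  let p : S := ⟨_, prod_mem_invariants k i, mul_mem hXi hXi'⟩
  let s' : S := ⟨_, add_mem hXj hXj', sum_mem_invariants k j⟩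
  let p' : S := ⟨_, mul_mem hXj hXj', prod_mem_invariants k j⟩
  let a : Poly k n := X i.castSucc
  let b : Poly k n := X j.castSucc
  have hs : (s : Poly k n) = a + X i.succ := rfl
  have hp : (p : Poly k n) = a * X i.succ := rfl
  have hs' : (s' : Poly k n) = b + X j.succ := rfl
  have hp' : (p' : Poly k n) = b * X j.succ := rfl
  clear_value s p s' p'
  refine generatedBy_induced ![1, a, b, a * b] fun f => ?_
  suffices ∃ c₀ c₁ c₂ c₃ : S, f = (c₀ : Poly k n) + c₁ * a + c₂ * b + c₃ * (a * b) by
    obtain ⟨c₀, c₁, c₂, c₃, rfl⟩ := this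
    exact ⟨![c₀, c₁, c₂, c₃], by simp [Fin.sum_univ_four]⟩
  induction f using MvPolynomial.induction_on with
  | C a => exact ⟨⟨C a, S.algebraMap_mem a⟩, 0, 0, 0, by simp⟩
  | add f g hf hg =>
    obtain ⟨c₀, c₁, c₂, c₃, rfl⟩ := hf
    obtain ⟨d₀, d₁, d₂, d₃, rfl⟩ := hg
    exact ⟨c₀ + d₀, c₁ + d₁, c₂ + d₂, c₃ + d₃, by push_cast; ring⟩
  | mul_X f l hf =>
    obtain ⟨c₀, c₁, c₂, c₃, rfl⟩ := hf
    by_cases h1 : l = i.castSucc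
    · subst h1
      exact ⟨-(c₁ * p), c₀ + c₁ * s, -(c₃ * p), c₂ + c₃ * s, by push_cast; rw [hp, hs]; ring⟩
    by_cases h2 : l = i.succ
    · subst h2
      exact ⟨c₀ * s + c₁ * p, -c₀, c₂ * s + c₃ * p, -c₂, by push_cast; rw [hp, hs]; ring⟩
    by_cases h3 : l = j.castSucc
    · subst h3
      exact ⟨-(c₂ * p'), -(c₃ * p'), c₀ + c₂ * s', c₁ + c₃ * s',
        by push_cast; rw [hp', hs']; ring⟩
    by_cases h4 : l = j.succ
    · subst h4
      exact ⟨c₀ * s' + c₂ * p', c₁ * s' + c₃ * p', -c₀, -c₁, by push_cast; rw [hp', hs']; ring⟩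
    let x : S := ⟨X l, X_mem_inf k h1 h2 h3 h4⟩
    exact ⟨c₀ * x, c₁ * x, c₂ * x, c₃ * x, by push_cast; ring⟩

/-- The elementary symmetric polynomials `e₁, e₂, e₃` of the three variables `a, b, c` involved lie
in `S`, and the six monomials `a^p b^q` with `p ≤ 2`, `q ≤ 1` span. -/
theorem generatedBy_induced_braid {i j : Fin n} (h : (j : ℕ) = i + 1) :
    GeneratedBy (induced (invariants k i ⊓ invariants k j)) 6 := by
  have hij : i.succ = j.castSucc := by
    rw [Fin.ext_iff, Fin.val_castSucc, Fin.val_succ, h]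
  have hne : i.castSucc ≠ j.castSucc ∧ i.castSucc ≠ j.succ ∧ j.succ ≠ i.succ := by
    simp only [ne_eq, Fin.ext_iff, Fin.val_castSucc, Fin.val_succ]
    omega
  let S := invariants k i ⊓ invariants k j
  have ha := X_mem_invariants k j hne.1 hne.2.1
  have hc := X_mem_invariants k i hne.2.1.symm hne.2.2
  have hs := sum_mem_invariants k i
  have hp := prod_mem_invariants k i
  have hs' := sum_mem_invariants k j
  have hp' := prod_mem_invariants k j
  rw [hij] at hs hp
  let a : Poly k n := X i.castSucc
  let b : Poly k n := X j.castSucc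
  let c : Poly k n := X j.succ
  let e₁ : S := ⟨a + b + c, add_mem hs hc, by rw [add_assoc]; exact add_mem ha hs'⟩
  let e₂ : S := ⟨a * b + (a + b) * c, add_mem hp (mul_mem hs hc), by
    rw [show a * b + (a + b) * c = a * (b + c) + b * c by ring]
    exact add_mem (mul_mem ha hs') hp'⟩
  let e₃ : S := ⟨a * b * c, mul_mem hp hc, by rw [mul_assoc]; exact mul_mem ha hp'⟩
  have h₁ : (e₁ : Poly k n) = a + b + c := rfl
  have h₂ : (e₂ : Poly k n) = a * b + (a + b) * c := rfl
  have h₃ : (e₃ : Poly k n) = a * b * c := rfl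
  clear_value e₁ e₂ e₃
  refine generatedBy_induced ![1, a, a ^ 2, b, a * b, a ^ 2 * b] fun f => ?_
  let E : Poly k n → Prop := fun f => ∃ c₀ c₁ c₂ c₃ c₄ c₅ : S, f = (c₀ : Poly k n) + c₁ * a +
    c₂ * a ^ 2 + c₃ * b + c₄ * (a * b) + c₅ * (a ^ 2 * b)
  suffices E f by
    obtain ⟨c₀, c₁, c₂, c₃, c₄, c₅, rfl⟩ := this
    exact ⟨![c₀, c₁, c₂, c₃, c₄, c₅], by simp [Fin.sum_univ_six]⟩
  have hadd : ∀ f g, E f → E g → E (f + g) := by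
    rintro _ _ ⟨c₀, c₁, c₂, c₃, c₄, c₅, rfl⟩ ⟨d₀, d₁, d₂, d₃, d₄, d₅, rfl⟩
    exact ⟨c₀ + d₀, c₁ + d₁, c₂ + d₂, c₃ + d₃, c₄ + d₄, c₅ + d₅, by push_cast; ring⟩
  have hmul : ∀ (s : S) (f), E f → E (s * f) := by
    rintro s _ ⟨c₀, c₁, c₂, c₃, c₄, c₅, rfl⟩
    exact ⟨s * c₀, s * c₁, s * c₂, s * c₃, s * c₄, s * c₅, by push_cast; ring⟩
  -- From `a³ = e₁ a² - e₂ a + e₃`.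
  have hfa : ∀ f, E f → E (f * a) := by
    rintro _ ⟨c₀, c₁, c₂, c₃, c₄, c₅, rfl⟩
    exact ⟨c₂ * e₃, c₀ - c₂ * e₂, c₁ + c₂ * e₁, c₅ * e₃, c₃ - c₅ * e₂, c₄ + c₅ * e₁, by
      push_cast; rw [h₁, h₂, h₃]; ring⟩
  -- From `b² = e₁ (a + b) - e₂ - a² - a b`.
  have hfb : ∀ f, E f → E (f * b) := by
    rintro _ ⟨c₀, c₁, c₂, c₃, c₄, c₅, rfl⟩
    exact ⟨-(c₃ * e₂) - c₄ * e₃, c₃ * e₁ - c₅ * e₃, -c₃, c₀ + c₃ * e₁ - c₅ * e₃,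
      c₁ - c₃ + c₄ * e₁ + c₅ * e₂, c₂ - c₄, by push_cast; rw [h₁, h₂, h₃]; ring⟩
  induction f using MvPolynomial.induction_on with
  | C r => exact ⟨⟨C r, S.algebraMap_mem r⟩, 0, 0, 0, 0, 0, by simp⟩
  | add f g hf hg => exact hadd f g hf hg
  | mul_X f l hf =>
    by_cases h1 : l = i.castSucc
    · subst h1
      exact hfa f hf
    by_cases h2 : l = j.castSucc
    · subst h2
      exact hfb f hf
    by_cases h3 : l = j.succ
    · subst h3
      -- The third variable is `e₁ - a - b`.
      have := hadd _ _ (hmul e₁ f hf) (hadd _ _ (hmul (-1) _ (hfa f hf)) (hmul (-1) _ (hfb f hf)))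
      rw [h₁] at this
      convert this using 1
      push_cast
      ring
    have := hmul ⟨X l, X_mem_inf k h1 (hij ▸ h2) h2 h3⟩ f hf
    rw [mul_comm]
    exact this

end Generators

/-! ### Lifts of the Hecke relations -/

section Relations

open MvPolynomial RBimod

variable {k}

/-- The element `1 ⊗ f ⊗ 1` of `B_i ⊗ B_j`. -/
noncomputable def mid (i j : Fin n) (f : Poly k n) : Tens (Bs k i) (Bs k j) :=
  tmul (op f • oneElt k i) (oneElt k j)

theorem mid_add (i j : Fin n) (f g : Poly k n) : mid i j (f + g) = mid i j f + mid i j g := by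
  rw [mid, MulOpposite.op_add, add_smul, add_tmul]
  rfl

theorem mid_mul_left {i : Fin n} (j : Fin n) {r : Poly k n} (hr : r ∈ invariants k i)
    (f : Poly k n) : mid i j (r * f) = r • mid i j f := by
  rw [mid, mid, smul_tmul, MulOpposite.op_mul, mul_smul, oneElt_comm k hr, smul_comm]

theorem mid_mul_right (i : Fin n) {j : Fin n} {r : Poly k n} (hr : r ∈ invariants k j)
    (f : Poly k n) : mid i j (f * r) = op r • mid i j f := by
  rw [mid, mid, op_smul_tmul, oneElt_comm k hr, ← tmul_balanced, MulOpposite.op_mul, mul_smul]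

@[elab_as_elim]
theorem mid_induction {i j : Fin n} {P : Tens (Bs k i) (Bs k j) → Prop}
    (x : Tens (Bs k i) (Bs k j)) (h0 : P 0) (hm : ∀ r s f : Poly k n, P (r • op s • mid i j f))
    (ha : ∀ x y, P x → P y → P (x + y)) : P x := by
  induction x using tens_induction with
  | h0 => exact h0
  | ht b b' =>
    induction b using bs_induction with
    | h0 => rw [zero_tmul]; exact h0
    | ht p q =>
      induction b' using bs_induction with
      | h0 => rw [tmul_zero]; exact h0
      | ht r s =>
        have : tmul (bs k i p q) (bs k j r s) = p • op s • mid i j (q * r) := by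
          rw [bs_eq, bs_eq, mid, op_smul_tmul, smul_tmul, ← tmul_balanced, smul_comm (op r) p,
            MulOpposite.op_mul, mul_smul]
        rw [this]
        exact hm _ _ _
      | ha x y hx hy => rw [tmul_add]; exact ha _ _ hx hy
    | ha x y hx hy => rw [add_tmul]; exact ha _ _ hx hy
  | ha x y hx hy => exact ha _ _ hx hy

/-- The surjectivity test used below: `B_i ⊗ B_j` is `R ⊗ R ⊗ R` over `R^i` and `R^j`, generated as
a bimodule by the elements `1 ⊗ f ⊗ 1`. -/
theorem eq_top_of_mid_mem {i j : Fin n} {T : AddSubgroup (Tens (Bs k i) (Bs k j))}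
    (hT : IsSubbimodule (M := Bs k i ⊗ Bs k j) T) (h : ∀ f, mid i j f ∈ T) : T = ⊤ := by
  refine eq_top_iff.mpr fun x _ => ?_
  clear * - hT h
  induction x using mid_induction with
  | h0 => exact zero_mem _
  | hm r s f => exact hT.smul_mem _ (hT.op_smul_mem _ (h _))
  | ha x y hx hy => exact add_mem hx hy

theorem mid_central {i j : Fin n} {r : Poly k n} (hi : r ∈ invariants k i)
    (hj : r ∈ invariants k j) (f : Poly k n) : op r • mid i j f = r • mid i j f := by
  rw [← mid_mul_left j hi, ← mid_mul_right i hj, mul_comm]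

/-- Splitting the middle factor as `R^i + R^i x_i` shows that `1 ⊗ 1 ⊗ 1` and `1 ⊗ x_i ⊗ 1`
generate. Each spans an image of `B_i`, and `2 + 2` generators meet rank `4`. -/
theorem nonempty_square (i : Fin n) : Nonempty (Bs k i ⊗ Bs k i ≅ Bs k i ⊞ Bs k i) := by
  let f₁ : Bs k i ⟶ Bs k i ⊗ Bs k i :=
    bsDesc k (M := Bs k i ⊗ Bs k i) (mid i i 1) fun r hr => mid_central hr hr 1
  let f₂ : Bs k i ⟶ Bs k i ⊗ Bs k i :=
    bsDesc k (M := Bs k i ⊗ Bs k i) (mid i i (X i.castSucc)) fun r hr => mid_central hr hr _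
  let f : Bs k i ⊞ Bs k i ⟶ Bs k i ⊗ Bs k i := biprod.desc f₁ f₂
  have h₁ : biprod.inl ≫ f = f₁ := biprod.inl_desc _ _
  have h₂ : biprod.inr ≫ f = f₂ := biprod.inr_desc _ _
  have hT := isSubbimodule_image f
  have hf : image f = ⊤ := by
    refine eq_top_of_mid_mem hT fun g => ?_
    obtain ⟨g, hg, h, hh, rfl⟩ := exists_decomp_castSucc k i g
    rw [mid_add, mid_mul_left i hh, ← mul_one g, mid_mul_left i hg]
    have m₁ := mem_image_of_comp biprod.inl f (oneElt k i)
    have m₂ := mem_image_of_comp biprod.inr f (oneElt k i)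
    rw [h₁, bsDesc_one] at m₁
    rw [h₂, bsDesc_one] at m₂
    exact add_mem (hT.smul_mem _ m₁) (hT.smul_mem _ m₂)
  have := isIso_of_surjective ((freeOfRank_Bs i).generatedBy.biprod (freeOfRank_Bs i).generatedBy)
    ((freeOfRank_Bs i).tensor i) f (surjective_of_image hf)
  exact ⟨(asIso f).symm⟩

/-- Here `1 ⊗ 1 ⊗ 1` alone generates: a middle `x_i` is `s_j`-invariant and leaves to the right,
while its `R^i`-coefficients leave to the left. -/
theorem nonempty_distant_induced (i j : Fin n) (h : (i : ℕ) + 2 ≤ j ∨ (j : ℕ) + 2 ≤ i) :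
    Nonempty (induced (invariants k i ⊓ invariants k j) ≅ Bs k i ⊗ Bs k j) := by
  let f : induced (invariants k i ⊓ invariants k j) ⟶ Bs k i ⊗ Bs k j :=
    inducedDesc (M := Bs k i ⊗ Bs k j) (mid i j 1) fun r hr => mid_central hr.1 hr.2 1
  have hT := isSubbimodule_image f
  have h1 := mem_image f (it _ 1 1)
  rw [inducedDesc_one] at h1
  have hX : (X i.castSucc : Poly k n) ∈ invariants k j := by
    refine X_mem_invariants k j ?_ ?_ <;>
    · simp only [ne_eq, Fin.ext_iff, Fin.val_castSucc, Fin.val_succ]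
      omega
  have hf : image f = ⊤ := by
    refine eq_top_of_mid_mem hT fun g => ?_
    obtain ⟨g, hg, h, hh, rfl⟩ := exists_decomp_castSucc k i g
    rw [mid_add, mid_mul_left j hh, ← mul_one g, mid_mul_left j hg, ← one_mul (X i.castSucc),
      mid_mul_right i hX]
    exact add_mem (hT.smul_mem _ h1) (hT.smul_mem _ (hT.op_smul_mem _ h1))
  have := isIso_of_surjective (generatedBy_induced_distant k h)
    ((freeOfRank_Bs j).tensor i) f (surjective_of_image hf)
  exact ⟨asIso f⟩

theorem nonempty_distant (i j : Fin n) (h : (i : ℕ) + 2 ≤ j ∨ (j : ℕ) + 2 ≤ i) :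
    Nonempty (Bs k i ⊗ Bs k j ≅ Bs k j ⊗ Bs k i) := by
  obtain ⟨e⟩ := nonempty_distant_induced (k := k) i j h
  obtain ⟨e'⟩ := nonempty_distant_induced (k := k) j i h.symm
  rw [inf_comm] at e'
  exact ⟨e.symm ≪≫ e'⟩

/-! ### The braid relation -/

/-- The element `1 ⊗ f ⊗ g ⊗ 1` of `B_i ⊗ B_j ⊗ B_i`. -/
noncomputable def mid₃ (i j : Fin n) (f g : Poly k n) : Tens (Bs k i) (tensor (Bs k j) (Bs k i)) :=
  tmul (N := tensor (Bs k j) (Bs k i)) (op f • oneElt k i) (mid j i g)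

theorem mid₃_add_left (i j : Fin n) (f f' g : Poly k n) :
    mid₃ i j (f + f') g = mid₃ i j f g + mid₃ i j f' g := by
  rw [mid₃, MulOpposite.op_add, add_smul, add_tmul (N := tensor (Bs k j) (Bs k i))]
  rfl

theorem mid₃_add_right (i j : Fin n) (f g g' : Poly k n) :
    mid₃ i j f (g + g') = mid₃ i j f g + mid₃ i j f g' := by
  rw [mid₃, mid_add]
  exact tmul_add (N := tensor (Bs k j) (Bs k i)) _ _ _

theorem mid₃_mul_left {i : Fin n} (j : Fin n) {r : Poly k n} (hr : r ∈ invariants k i)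
    (f g : Poly k n) : mid₃ i j (r * f) g = r • mid₃ i j f g := by
  rw [mid₃, mid₃, smul_tmul (N := tensor (Bs k j) (Bs k i)), MulOpposite.op_mul, mul_smul,
    oneElt_comm k hr, smul_comm]

theorem mid₃_mul_right {i : Fin n} (j : Fin n) {r : Poly k n} (hr : r ∈ invariants k i)
    (f g : Poly k n) : mid₃ i j f (g * r) = op r • mid₃ i j f g := by
  rw [mid₃, mid₃, op_smul_tmul (N := tensor (Bs k j) (Bs k i)), mid_mul_right j hr]

theorem mid₃_mul_mid (i : Fin n) {j : Fin n} {r : Poly k n} (hr : r ∈ invariants k j)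
    (f g : Poly k n) : mid₃ i j (f * r) g = mid₃ i j f (r * g) := by
  rw [mid₃, mid₃, mid_mul_left i hr, ← tmul_balanced (N := tensor (Bs k j) (Bs k i)),
    MulOpposite.op_mul, mul_smul]

theorem eq_top_of_mid₃_mem {i j : Fin n}
    {T : AddSubgroup (Tens (Bs k i) (tensor (Bs k j) (Bs k i)))}
    (hT : IsSubbimodule (M := tensor (Bs k i) (tensor (Bs k j) (Bs k i))) T)
    (h : ∀ f g, mid₃ i j f g ∈ T) : T = ⊤ := by
  refine eq_top_iff.mpr fun x _ => ?_
  clear * - hT h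
  induction x using tens_induction with
  | h0 => exact zero_mem _
  | ht b y =>
    induction b using bs_induction with
    | h0 => rw [zero_tmul (N := tensor (Bs k j) (Bs k i))]; exact zero_mem _
    | ht p q =>
      induction y using mid_induction with
      | h0 => rw [tmul_zero (N := tensor (Bs k j) (Bs k i))]; exact zero_mem _
      | hm r s f =>
        have : tmul (N := tensor (Bs k j) (Bs k i)) (bs k i p q) (r • op s • mid j i f) =
            p • op s • mid₃ i j (q * r) f := by
          rw [bs_eq, mid₃, op_smul_tmul (N := tensor (Bs k j) (Bs k i)),
            smul_tmul (N := tensor (Bs k j) (Bs k i)),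
            ← tmul_balanced (N := tensor (Bs k j) (Bs k i)), smul_comm (op r) p,
            MulOpposite.op_mul, mul_smul]
        rw [this]
        exact hT.smul_mem _ (hT.op_smul_mem _ (h _ _))
      | ha x x' hx hx' =>
        rw [tmul_add (N := tensor (Bs k j) (Bs k i))]
        exact add_mem hx hx'
    | ha x x' hx hx' =>
      rw [add_tmul (N := tensor (Bs k j) (Bs k i))]
      exact add_mem hx hx'
  | ha x x' hx hx' => exact add_mem hx hx'

/-- The element `1 ⊗ (x_j ⊗ 1 - 1 ⊗ x_{j+1}) ⊗ 1` of `B_i ⊗ B_j ⊗ B_i`. -/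
noncomputable def midDot (i j : Fin n) : Tens (Bs k i) (tensor (Bs k j) (Bs k i)) :=
  tmul (N := tensor (Bs k j) (Bs k i)) (oneElt k i) (tmul (dotEl k j) (oneElt k i))

theorem midDot_eq (i j : Fin n) :
    midDot i j = mid₃ (k := k) i j (X j.castSucc) 1 - mid₃ i j 1 (X j.succ) := by
  have h : tmul (dotEl k j) (oneElt k i) =
      (X j.castSucc : Poly k n) • mid (k := k) j i 1 - mid j i (X j.succ) := by
    rw [eq_sub_iff_add_eq, dotEl_eq, mid, mid, smul_tmul, ← add_tmul, MulOpposite.op_one, one_smul,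
      bs_eq, bs_eq, MulOpposite.op_one, one_smul, one_smul, sub_add_cancel]
  rw [midDot, h, eq_sub_iff_add_eq, mid₃, mid₃, MulOpposite.op_one, one_smul,
    tmul_balanced (N := tensor (Bs k j) (Bs k i)), ← tmul_add (N := tensor (Bs k j) (Bs k i)),
    sub_add_cancel]

theorem midDot_central (i j : Fin n) {r : Poly k n} (hr : r ∈ invariants k i) :
    op r • midDot (k := k) i j = r • midDot i j := by
  rw [midDot, op_smul_tmul (N := tensor (Bs k j) (Bs k i)), op_smul_tmul, oneElt_comm k hr,
    ← tmul_balanced, dotEl_central, ← smul_tmul, ← tmul_balanced (N := tensor (Bs k j) (Bs k i)),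
    oneElt_comm k hr, smul_tmul (N := tensor (Bs k j) (Bs k i))]

/-- `B_i ⊗ B_j ⊗ B_i` is the direct sum of `R ⊗_S R` and `B_i`, where `S` is the ring of polynomials
invariant under `s_i` and `s_j`. -/
theorem nonempty_braid_biprod (i j : Fin n) (b z : Fin (n + 1)) {S : Subalgebra k (Poly k n)}
    (hS : S ≤ invariants k i ⊓ invariants k j) (hgen : GeneratedBy (induced S) 6)
    (hi : ∀ f : Poly k n, ∃ g ∈ invariants k i, ∃ h ∈ invariants k i, f = g + h * X b)
    (hj : ∀ f : Poly k n, ∃ g ∈ invariants k j, ∃ h ∈ invariants k j, f = g + h * X z)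
    (hz : X z ∈ invariants k i)
    -- The one point where the cases `j = i + 1` and `i = j + 1` differ: how the two generators
    -- yield `1 ⊗ x_b ⊗ 1 ⊗ 1`.
    (hb : ∀ T : AddSubgroup (Tens (Bs k i) (tensor (Bs k j) (Bs k i))),
      IsSubbimodule (M := tensor (Bs k i) (tensor (Bs k j) (Bs k i))) T → mid₃ i j 1 1 ∈ T →
      midDot i j ∈ T → mid₃ i j (X b) 1 ∈ T) :
    Nonempty (induced S ⊞ Bs k i ≅ Bs k i ⊗ Bs k j ⊗ Bs k i) := by
  let f₁ : induced S ⟶ Bs k i ⊗ Bs k j ⊗ Bs k i :=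
    inducedDesc (M := Bs k i ⊗ Bs k j ⊗ Bs k i) (mid₃ i j 1 1) fun r hr => by
      have h := hS hr
      have h1 := mid₃_mul_left j h.1 1 1
      have h2 := mid₃_mul_right j h.1 1 1
      refine h2.symm.trans (Eq.trans ?_ h1)
      rw [mul_comm r, mid₃_mul_mid i h.2, mul_comm]
  let f₂ : Bs k i ⟶ Bs k i ⊗ Bs k j ⊗ Bs k i :=
    bsDesc k (M := Bs k i ⊗ Bs k j ⊗ Bs k i) (midDot i j) fun r hr => midDot_central i j hr
  let f : induced S ⊞ Bs k i ⟶ Bs k i ⊗ Bs k j ⊗ Bs k i := biprod.desc f₁ f₂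
  have h₁ : biprod.inl ≫ f = f₁ := biprod.inl_desc _ _
  have h₂ : biprod.inr ≫ f = f₂ := biprod.inr_desc _ _
  have hT := isSubbimodule_image f
  have hf : image f = ⊤ := by
    refine eq_top_of_mid₃_mem hT fun p q => ?_
    have m₁ := mem_image_of_comp biprod.inl f (it S 1 1)
    have m₂ := mem_image_of_comp biprod.inr f (oneElt k i)
    rw [h₁, inducedDesc_one] at m₁
    rw [h₂, bsDesc_one] at m₂
    have mb := hb _ hT m₁ m₂
    have m₃ : ∀ p, mid₃ i j p 1 ∈ image f := fun p => by
      obtain ⟨g, hg, h, hh, rfl⟩ := hi p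
      rw [mid₃_add_left, mid₃_mul_left j hh, ← mul_one g, mid₃_mul_left j hg]
      exact add_mem (hT.smul_mem _ m₁) (hT.smul_mem _ mb)
    obtain ⟨g, hg, h, hh, rfl⟩ := hj q
    -- The `R^j`-coefficients of the third factor cross into the second, and `x_z`, being
    -- `s_i`-invariant, leaves to the right.
    rw [mid₃_add_right, ← mid₃_mul_mid i hh, ← mul_one g, ← mid₃_mul_mid i hg, ← one_mul (X z),
      mid₃_mul_right j hz]
    exact add_mem (m₃ _) (hT.op_smul_mem _ (m₃ _))
  -- `6 + 2` generators against rank `2³ = 8`.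
  have := isIso_of_surjective (hgen.biprod (freeOfRank_Bs i).generatedBy)
    (((freeOfRank_Bs i).tensor j).tensor i) f (surjective_of_image hf)
  exact ⟨asIso f⟩

/-- Both sides are `(R ⊗_S R) ⊕ B_i ⊕ B_j` with the same `S`, up to the order of the summands. -/
theorem nonempty_braid (i j : Fin n) (h : (j : ℕ) = i + 1) :
    Nonempty ((Bs k i ⊗ Bs k j ⊗ Bs k i) ⊞ Bs k j ≅ (Bs k j ⊗ Bs k i ⊗ Bs k j) ⊞ Bs k i) := by
  have hij : j.castSucc = i.succ := by
    rw [Fin.ext_iff, Fin.val_castSucc, Fin.val_succ, h]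
  have hne : i.castSucc ≠ j.castSucc ∧ i.castSucc ≠ j.succ ∧ j.succ ≠ i.succ := by
    simp only [ne_eq, Fin.ext_iff, Fin.val_castSucc, Fin.val_succ]
    omega
  have ha := X_mem_invariants k j hne.1 hne.2.1
  have hc := X_mem_invariants k i hne.2.1.symm hne.2.2
  have hgen := generatedBy_induced_braid k h
  obtain ⟨e⟩ := nonempty_braid_biprod i j j.castSucc j.succ le_rfl hgen
    (hij ▸ exists_decomp_succ k i) (exists_decomp_succ k j) hc fun T hT h1 hd => by
      -- The subtracted term `1 ⊗ 1 ⊗ x_{j+1} ⊗ 1` is a right multiple of the first generator, since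
      -- `x_{j+1}` is `s_i`-invariant.
      rw [midDot_eq] at hd
      have := add_mem hd (hT.op_smul_mem (X j.succ) h1)
      rwa [← mid₃_mul_right j hc, one_mul, sub_add_cancel] at this
  obtain ⟨e'⟩ := nonempty_braid_biprod j i j.castSucc i.castSucc (inf_comm _ _).le hgen
    (exists_decomp_castSucc k j) (exists_decomp_castSucc k i) ha fun T hT h1 hd => by
      rw [midDot_eq] at hd
      have h2 := hT.smul_mem (X i.castSucc) h1
      have h3 := hT.op_smul_mem (X i.castSucc) h1
      rw [← mid₃_mul_left i ha, mul_one] at h2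
      rw [← mid₃_mul_right i ha, one_mul] at h3
      -- Now `x_i` is `s_j`-invariant and may leave on either side, which gives `1 ⊗ 1 ⊗ x_{i+1} ⊗
      -- 1`. The `s_i`-invariant sum `x_i + x_{i+1}` then crosses the middle tensor sign, and
      -- subtracting `x_i` leaves `x_{i+1} = x_j` in the second factor.
      have h4 : mid₃ j i 1 (X i.succ) ∈ T := by
        have := sub_mem h2 hd
        rwa [sub_sub_cancel] at this
      have h5 : mid₃ (k := k) j i (X i.castSucc + X i.succ) 1 ∈ T := by
        rw [← one_mul (X i.castSucc + X i.succ), mid₃_mul_mid j (sum_mem_invariants k i), mul_one,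
          mid₃_add_right]
        exact add_mem h3 h4
      rw [mid₃_add_left] at h5
      have := sub_mem h5 h2
      rw [add_sub_cancel_left] at this
      rwa [hij]
  exact ⟨biprod.mapIso e.symm (Iso.refl _) ≪≫ biprod.associator _ _ _ ≪≫
    biprod.mapIso (Iso.refl _) (biprod.braiding _ _) ≪≫ (biprod.associator _ _ _).symm ≪≫
    biprod.mapIso e' (Iso.refl _)⟩

/-! ### Self-duality of `B_i` -/

/-- The functional `f ⊗ g ↦ f ∂_i(g)` on `B_i`. -/
noncomputable def trace (i : Fin n) : Bs k i →+ Poly k n :=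
  inducedLift (S := invariants k i)
    (AddMonoidHom.mul.compl₂ (AddMonoidHom.mk' (demazure k i) (demazure_add k i)))
    (fun r f g => by
      change r * f * demazure k i g = f * demazure k i (r * g)
      rw [demazure_invariant_mul k r.2]
      ring)

theorem trace_bs (i : Fin n) (f g : Poly k n) : trace i (bs k i f g) = f * demazure k i g := rfl

theorem trace_smul (i : Fin n) (r : Poly k n) (b : Bs k i) :
    trace i (r • b) = r * trace i b := by
  induction b using bs_induction with
  | h0 => rw [smul_zero, map_zero, mul_zero]
  | ht f g => rw [smul_bs, trace_bs, trace_bs, mul_assoc]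
  | ha x y hx hy => rw [smul_add, map_add, map_add, hx, hy, mul_add]

theorem trace_op_smul (i : Fin n) {r : Poly k n} (hr : r ∈ invariants k i) (b : Bs k i) :
    trace i (op r • b) = r * trace i b := by
  induction b using bs_induction with
  | h0 => rw [smul_zero, map_zero, mul_zero]
  | ht f g =>
    rw [op_smul_bs, trace_bs, trace_bs, mul_comm g, demazure_invariant_mul k hr]
    ring
  | ha x y hx hy => rw [smul_add, map_add, map_add, hx, hy, mul_add]

/-- The biadditive map `(g, h) ↦ trace (b g) h`. -/
noncomputable def traceAct (i : Fin n) (b : Bs k i) : Poly k n →+ Poly k n →+ Poly k n :=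
  AddMonoidHom.mul.comp (AddMonoidHom.mk' (fun g => trace i (op g • b)) fun g g' => by
    rw [MulOpposite.op_add, add_smul, map_add])

/-- The map `g ⊗ h ↦ trace (b g) h` on `B_i`. -/
noncomputable def pairingLeft (i : Fin n) (b : Bs k i) : Bs k i →+ Poly k n :=
  inducedLift (S := invariants k i) (traceAct i b)
    (fun r g h => by
      change trace i (op (r * g) • b) * h = trace i (op g • b) * (r * h)
      rw [mul_comm, MulOpposite.op_mul, mul_smul, smul_comm, trace_op_smul i r.2]
      ring)

theorem pairingLeft_bs (i : Fin n) (b : Bs k i) (g h : Poly k n) :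
    pairingLeft i b (bs k i g h) = trace i (op g • b) * h := rfl

/-- The pairing `(f ⊗ g, g' ⊗ h) ↦ f ∂_i(g g') h`. -/
noncomputable def pairing (i : Fin n) : Bs k i →+ Bs k i →+ Poly k n :=
  AddMonoidHom.mk' (pairingLeft i) fun b b' => AddMonoidHom.ext fun x => by
    rw [AddMonoidHom.add_apply]
    induction x using bs_induction with
    | h0 => rw [map_zero, map_zero, map_zero, add_zero]
    | ht g h => rw [pairingLeft_bs, pairingLeft_bs, pairingLeft_bs, smul_add, map_add, add_mul]
    | ha x y hx hy =>
      rw [map_add, map_add, map_add, hx, hy]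
      abel

theorem pairing_bs (i : Fin n) (b : Bs k i) (g h : Poly k n) :
    pairing i b (bs k i g h) = trace i (op g • b) * h := rfl

/-- The counit `B_i ⊗ B_i ⟶ R`, sending `f ⊗ g ⊗ h` to `f ∂_i(g) h`. -/
noncomputable def cap (i : Fin n) : Bs k i ⊗ Bs k i ⟶ 𝟙_ (RBimod (Poly k n)) :=
  tensDesc (M := Bs k i) (N := Bs k i) (P := unit (Poly k n)) (pairing i)
    (fun r b x => by
      induction x using bs_induction with
      | h0 => rw [smul_zero, map_zero, map_zero]
      | ht g h => rw [smul_bs, pairing_bs, pairing_bs, MulOpposite.op_mul, mul_smul, smul_comm]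
      | ha x y hx hy => rw [smul_add, map_add, map_add, hx, hy])
    (fun r b x => by
      change _ = r * pairing i b x
      induction x using bs_induction with
      | h0 => rw [map_zero, map_zero, mul_zero]
      | ht g h => rw [pairing_bs, pairing_bs, smul_comm, trace_smul, mul_assoc]
      | ha x y hx hy => rw [map_add, map_add, hx, hy, mul_add])
    (fun r b x => by
      change _ = pairing i b x * r
      induction x using bs_induction with
      | h0 => rw [smul_zero, map_zero, zero_mul]
      | ht g h => rw [op_smul_bs, pairing_bs, pairing_bs, mul_assoc]
      | ha x y hx hy => rw [smul_add, map_add, map_add, hx, hy, add_mul])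

theorem cap_tmul (i : Fin n) (b : Bs k i) (g h : Poly k n) :
    cap i (tmul b (bs k i g h)) = trace i (op g • b) * h := rfl

/-- The unit `R ⟶ B_i ⊗ B_i`, sending `1` to `x_i ⊗ 1 ⊗ 1 - 1 ⊗ 1 ⊗ x_{i+1}`. -/
noncomputable def cup (i : Fin n) : 𝟙_ (RBimod (Poly k n)) ⟶ Bs k i ⊗ Bs k i :=
  dot k i ≫ bsDesc k (M := Bs k i ⊗ Bs k i) (mid i i 1) fun _ hr => mid_central hr hr 1

theorem cup_one (i : Fin n) : cup i (1 : Poly k n) =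
    tmul (bs k i (X i.castSucc) 1) (bs k i 1 1) - tmul (bs k i 1 1) (bs k i 1 (X i.succ)) := by
  have h : ∀ r ∈ invariants k i, op r • (show (Bs k i ⊗ Bs k i : RBimod (Poly k n)) from mid i i 1) =
      r • (show (Bs k i ⊗ Bs k i : RBimod (Poly k n)) from mid i i 1) :=
    fun _ hr => mid_central hr hr 1
  change bsDesc k (M := Bs k i ⊗ Bs k i) (mid i i 1) h ((1 : Poly k n) • dotEl k i) = _
  rw [one_smul, dotEl_eq, map_sub, bsDesc_bs, bsDesc_bs, MulOpposite.op_one, one_smul, one_smul]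
  refine congrArg₂ (· - ·) ?_ ?_
  · change _ • tmul (op 1 • oneElt k i) (oneElt k i) = _
    rw [smul_tmul, MulOpposite.op_one, one_smul, oneElt, smul_bs, mul_one]
  · change _ • tmul (op 1 • oneElt k i) (oneElt k i) = _
    rw [op_smul_tmul, MulOpposite.op_one, one_smul, oneElt, op_smul_bs, one_mul]

theorem cap_one_tmul (i : Fin n) (g h : Poly k n) :
    cap i (tmul (oneElt k i) (bs k i g h)) = demazure k i g * h := by
  rw [cap_tmul, oneElt, op_smul_bs, trace_bs, one_mul, one_mul]

theorem cap_tmul_one (i : Fin n) (f g : Poly k n) :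
    cap i (tmul (bs k i f g) (oneElt k i)) = f * demazure k i g := by
  rw [oneElt, cap_tmul, MulOpposite.op_one, one_smul, trace_bs, mul_one]

/-- By `bs_hom_ext` it is enough to test on `1 ⊗ 1`, where the zigzag reduces to `∂_i(x_i) = 1` and
`∂_i(1) = 0`. Behind it, `x_i, 1` and `1, -x_{i+1}` are dual bases for the form `∂_i(f g)`. -/
theorem cup_cap (i : Fin n) : Bs k i ◁ cup i ≫ (α_ (Bs k i) (Bs k i) (Bs k i)).inv ≫
    cap i ▷ Bs k i = (ρ_ (Bs k i)).hom ≫ (λ_ (Bs k i)).inv := by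
  refine (cancel_epi (ρ_ (Bs k i)).inv).mp (bs_hom_ext k ?_)
  rw [Iso.inv_hom_id_assoc]
  change (cap i ▷ Bs k i) ((α_ (Bs k i) (Bs k i) (Bs k i)).inv
    (tmulHom (Bs k i) (tensor (Bs k i) (Bs k i)) (oneElt k i) (cup i (1 : Poly k n)))) =
      tmulHom (unit (Poly k n)) (Bs k i) (1 : Poly k n) (oneElt k i)
  rw [cup_one, map_sub, map_sub, map_sub]
  change tmulHom (unit (Poly k n)) (Bs k i)
      (cap i (tmul (oneElt k i) (bs k i (X i.castSucc) 1))) (bs k i 1 1) -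
    tmulHom (unit (Poly k n)) (Bs k i)
      (cap i (tmul (oneElt k i) (bs k i 1 1))) (bs k i 1 (X i.succ)) = _
  rw [cap_one_tmul, cap_one_tmul, demazure_X_castSucc, demazure_of_mem k (one_mem _), zero_mul,
    one_mul]
  change tmul (M := unit (Poly k n)) (1 : Poly k n) (oneElt k i) -
    tmul (M := unit (Poly k n)) (0 : Poly k n) _ = _
  rw [zero_tmul (M := unit (Poly k n)), sub_zero]
  rfl

/-- The mirror image, which rests on `∂_i(1) = 0` and `∂_i(x_{i+1}) = -1`. -/
theorem cap_cup (i : Fin n) : cup i ▷ Bs k i ≫ (α_ (Bs k i) (Bs k i) (Bs k i)).hom ≫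
    Bs k i ◁ cap i = (λ_ (Bs k i)).hom ≫ (ρ_ (Bs k i)).inv := by
  refine (cancel_epi (λ_ (Bs k i)).inv).mp (bs_hom_ext k ?_)
  rw [Iso.inv_hom_id_assoc]
  change (Bs k i ◁ cap i) ((α_ (Bs k i) (Bs k i) (Bs k i)).hom
    ((tmulHom (tensor (Bs k i) (Bs k i)) (Bs k i)).flip (oneElt k i) (cup i (1 : Poly k n)))) =
      tmulHom (Bs k i) (unit (Poly k n)) (oneElt k i) (1 : Poly k n)
  rw [cup_one, map_sub, map_sub, map_sub]
  change tmulHom (Bs k i) (unit (Poly k n)) (bs k i (X i.castSucc) 1)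
      (cap i (tmul (bs k i 1 1) (oneElt k i))) -
    tmulHom (Bs k i) (unit (Poly k n)) (bs k i 1 1)
      (cap i (tmul (bs k i 1 (X i.succ)) (oneElt k i))) = _
  rw [cap_tmul_one, cap_tmul_one, demazure_X_succ, demazure_of_mem k (one_mem _), mul_zero,
    one_mul]
  change tmulHom (Bs k i) (unit (Poly k n)) _ (0 : unit (Poly k n)) -
    tmulHom (Bs k i) (unit (Poly k n)) (oneElt k i) (-(1 : Poly k n) : unit (Poly k n)) = _
  rw [map_zero, map_neg, zero_sub, neg_neg]

/-- `B_i` is its own dual. -/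
@[reducible]
noncomputable def selfDual (i : Fin n) : ExactPairing (Bs k i) (Bs k i) where
  coevaluation' := cup i
  evaluation' := cap i
  coevaluation_evaluation' := cup_cap i
  evaluation_coevaluation' := cap_cup i

end Relations

theorem nonempty_heckeChoice : Nonempty (HeckeChoice k n) :=
  ⟨{ square := fun i => (nonempty_square i).some
     distant := fun i j h => (nonempty_distant i j h).some
     braid := fun i j h => (nonempty_braid i j h).some
     selfDual := selfDual }⟩

end

end Soergel


theorem proposition2p1 (k : Type*) [CommRing k] (n : ℕ) :
    Nonempty (Soergel.HeckeChoice k n) ∧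
      ∀ D : Soergel.HeckeChoice k n,
        (CategoryTheory.wideSubcategoryInclusion (Soergel.subcategory D)).Full ∧
          Soergel.subcategory D = ⊤ := by
  refine ⟨Soergel.nonempty_heckeChoice k, fun D => ⟨⟨fun f => ?_⟩, ?_⟩⟩
  · exact ⟨⟨f, Soergel.full D _ _ f.hom⟩, rfl⟩
  · ext v w f
    exact iff_of_true (Soergel.full D v w f.hom) trivial
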